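/- Let $n\ge 1$ and let $\mathcal B=(a_1,b_1)\times\dots\times(a_n,b_n)\subset\mathbb R^n$ with $-\infty<a_i<b_i<\infty$ be a rectangular box. For $\alpha\in\mathbb R$ consider the Robin eigenvalue problem $$-\Delta u=\lambda u \ \text{ in } \mathcal B,\qquad \frac{\partial u}{\partial\nu}+\alpha u=0\ \text{ on }\partial\mathcal B,$$ where $\nu$ is the outward unit normal, understood in the weak sense: $0\ne u\in H^1(\mathcal B)$ and $$\int_{\mathcal B}\nabla u\cdot\nabla v\,dx+\alpha\int_{\partial\mathcal B}uv\,dS=\lambda\int_{\mathcal B}uv\,dx\quad\text{for all } v\in H^1(\mathcal B),$$ with boundary values taken in the sense of traces. Let $\lambda_1(\mathcal B;\alpha)\le\lambda_2(\mathcal B;\alpha)\le\cdots$ be its eigenvalues, in increasing order and repeated according to multiplicity. Then the first two eigenvalues $\lambda_1(\mathcal B;\alpha)$ and $\lambda_2(\mathcal B;\alpha)$ exist for every $\alpha\in\mathbb R$, and both $\alpha\mapsto\lambda_1(\mathcal B;\alpha)$ and $\alpha\mapsto\lambda_2(\mathcal B;\alpha)$ are strictly concave functions on all of $\mathbb R$.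 -/

import Mathlib

open MeasureTheory Filter Topology
open scoped ContDiff

noncomputable section

namespace RobinBox

variable {n : ℕ}

/-- The open rectangular box `∏ i, (a i, b i)` in `ℝⁿ`. -/
def box (a b : Fin n → ℝ) : Set (Fin n → ℝ) :=
  Set.univ.pi fun i => Set.Ioo (a i) (b i)

/-- Lebesgue measure on the box. -/
def boxMeasure (a b : Fin n → ℝ) : Measure (Fin n → ℝ) :=
  volume.restrict (box a b)

/-- The `(n-1)`-dimensional Lebesgue measure carried by the face of the box that lies in the
hyperplane `x i = c`: a point mass at `c` in the `i`-th coordinate, times Lebesgue measure on the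
interval `(a j, b j)` in each coordinate `j ≠ i`. -/
def faceMeasure (a b : Fin n → ℝ) (i : Fin n) (c : ℝ) : Measure (Fin n → ℝ) :=
  Measure.pi (Function.update
    (fun j => (volume : Measure ℝ).restrict (Set.Ioo (a j) (b j))) i (Measure.dirac c))

/-- The surface measure `dS` on the boundary of the box: the sum over its `2n` faces
`x i = a i` and `x i = b i`. -/
def surfaceMeasure (a b : Fin n → ℝ) : Measure (Fin n → ℝ) :=
  ∑ i, (faceMeasure a b i (a i) + faceMeasure a b i (b i))

/-- The real Hilbert space `L²(B)`. -/
abbrev L2 (a b : Fin n → ℝ) := Lp ℝ 2 (boxMeasure a b)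

/-- The real Hilbert space `L²(∂B)`. -/
abbrev L2Boundary (a b : Fin n → ℝ) := Lp ℝ 2 (surfaceMeasure a b)

/-- The classical partial derivative `∂φ/∂xᵢ`. -/
def partialDeriv (i : Fin n) (φ : (Fin n → ℝ) → ℝ) (x : Fin n → ℝ) : ℝ :=
  fderiv ℝ φ x (Pi.single i 1)

/-- `G = (G₁, …, Gₙ)` with `Gᵢ ∈ L²(B)` is the weak (distributional) gradient of `u ∈ L²(B)`.
Thus `u` belongs to the Sobolev space `H¹(B)` exactly when such a `G` exists. -/
def HasWeakGradient {a b : Fin n → ℝ} (u : L2 a b) (G : Fin n → L2 a b) : Prop :=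
  ∀ (i : Fin n) (φ : (Fin n → ℝ) → ℝ), ContDiff ℝ ∞ φ → HasCompactSupport φ →
    tsupport φ ⊆ box a b →
    ∫ x, u x * partialDeriv i φ x ∂boxMeasure a b = -∫ x, G i x * φ x ∂boxMeasure a b

/-- `g ∈ L²(∂B)` is the boundary trace of the function `u ∈ H¹(B)` with weak gradient `G`:
there are functions `φ m`, smooth up to the boundary, that converge to `u` in `H¹(B)` and whose
restrictions to the boundary converge to `g` in `L²(∂B)`.  By the trace theorem every
`u ∈ H¹(B)` has exactly one trace. -/
def HasTrace {a b : Fin n → ℝ} (u : L2 a b) (G : Fin n → L2 a b) (g : L2Boundary a b) : Prop :=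
  ∃ φ : ℕ → (Fin n → ℝ) → ℝ, (∀ m, ContDiff ℝ ∞ (φ m)) ∧
    Tendsto (fun m => eLpNorm (fun x => φ m x - u x) 2 (boxMeasure a b)) atTop (𝓝 0) ∧
    (∀ i, Tendsto (fun m => eLpNorm (fun x => partialDeriv i (φ m) x - G i x) 2
      (boxMeasure a b)) atTop (𝓝 0)) ∧
    Tendsto (fun m => eLpNorm (fun x => φ m x - g x) 2 (surfaceMeasure a b)) atTop (𝓝 0)

/-- `u ∈ H¹(B)` is a (nonzero) eigenfunction, with eigenvalue `ν`, of the Robin Laplacian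
`-Δu = ν u` in `B`, `∂u/∂normal + α u = 0` on `∂B`, in the weak sense:
`∫_B ∇u·∇v dx + α ∫_∂B u v dS = ν ∫_B u v dx` for all `v ∈ H¹(B)`.
Here `g`, `h` are the traces of `u`, `v`. -/
def IsRobinEigenfunction (a b : Fin n → ℝ) (α ν : ℝ) (u : L2 a b) : Prop :=
  u ≠ 0 ∧ ∃ (G : Fin n → L2 a b) (g : L2Boundary a b),
    HasWeakGradient u G ∧ HasTrace u G g ∧
    ∀ (v : L2 a b) (H : Fin n → L2 a b) (h : L2Boundary a b),
      HasWeakGradient v H → HasTrace v H h →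
      ∫ x, ∑ i, G i x * H i x ∂boxMeasure a b + α * ∫ x, g x * h x ∂surfaceMeasure a b
        = ν * ∫ x, u x * v x ∂boxMeasure a b

/-- The numbers `μ` such that, counted with multiplicity, at least `k` Robin eigenvalues of the
box are `≤ μ`, i.e. there are `k` linearly independent eigenfunctions with eigenvalues `≤ μ`. -/
def robinLevels (a b : Fin n → ℝ) (α : ℝ) (k : ℕ) : Set ℝ :=
  {μ | ∃ u : Fin k → L2 a b, LinearIndependent ℝ u ∧
    ∀ j, ∃ ν ≤ μ, IsRobinEigenfunction a b α ν (u j)}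

/-- The `k`-th Robin eigenvalue `λₖ(B; α)` of the box (`k = 1, 2, …`), the eigenvalues being
listed in increasing order and repeated according to multiplicity. -/
def robinEigenvalue (a b : Fin n → ℝ) (k : ℕ) (α : ℝ) : ℝ :=
  sInf (robinLevels a b α k)

end RobinBox

end

noncomputable section

namespace RobinBox

/-! The problem separates. On an interval let `μ i α < ν i α` be the two lowest Robin eigenvalues of
the `i`-th edge. Then the first eigenvalue of the box is `∑ i, μ i α`, and the second is `∑ i, μ i α
+ min_j (ν j α - μ j α)`, i.e. the minimum over `j` of `ν j α + ∑ i ≠ j, μ i α`. Sums and finite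
minima of strictly concave functions are strictly concave, so two things remain: concavity on an
interval, and the proof that nothing else lies at the bottom of the spectrum of the box.

Concavity on an interval. About the midpoint the two modes are even (`cos`, `1`, `cosh`) and odd
(`sin`, `x`, `sinh`), positive on the right half. Let `y`, `z` be modes of the same parity for `α`,
`β`, with eigenvalues `μ`, `ν`. The Wronskian identity on `(0, l)` reads `(ν - μ) ∫ y z = y(l) z(l)
(β - α)`. The same identity on `(0, x)` makes `z / y` monotone, whence `ν - μ < y(l)² / (∫ y²) * (β
- α)`: a strict supporting line at every `α` (`HalfMode.lt_supportingLine`).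

Bottom of the spectrum. Neither compactness nor completeness of the modes is used. Instead a gap
inequality `Q(f) - μ ‖f‖² ≥ (ν - μ) (‖f‖² - ⟨f, φ⟩²)` is proved directly on an interval (`gap_le`).
Its left side is `∫ (f' - (φ'/φ) f)²`, and it follows by duality from a Hardy inequality whose
positive solution is the Wronskian of the two modes. Fubini and commuting one-variable projections
onto the `φ i` tensorise it (`integral_sq_sub_le_sum`, `gap_box`), and smooth approximation carries
it to `H¹` (`gap_form`). An eigenfunction inserted there is either a multiple of the product ground
state or has eigenvalue above the gap (`IsRobinEigenfunction.dichotomy`); product modes attain both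
levels. -/

/-! ### Half-interval Robin modes -/

/-- A smooth solution of `y'' = -μ y`, positive on `(0, l]`, with the Robin condition at `l`. -/
structure HalfMode (l α μ : ℝ) (y : ℝ → ℝ) : Prop where
  smooth : ContDiff ℝ ∞ y
  ode : ∀ x, HasDerivAt (deriv y) (-μ * y x) x
  pos : ∀ x, 0 < x → x ≤ l → 0 < y x
  robin : deriv y l = -α * y l

/-- An even Robin mode of `(-l, l)`, positive on `[-l, l]`. -/
structure EvenMode (l α μ : ℝ) (y : ℝ → ℝ) : Prop extends HalfMode l α μ y where
  even : ∀ x, y (-x) = y x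
  pos_zero : 0 < y 0
  deriv_zero : deriv y 0 = 0

/-- An odd Robin mode of `(-l, l)`, positive on `(0, l]`. -/
structure OddMode (l α μ : ℝ) (y : ℝ → ℝ) : Prop extends HalfMode l α μ y where
  odd : ∀ x, y (-x) = -y x
  zero : y 0 = 0
  deriv_zero_pos : 0 < deriv y 0

/-! ### Explicit even and odd modes for every Robin parameter -/

theorem evenMode_cos {l α k : ℝ} (hk : 0 < k) (hkl : k * l < Real.pi / 2)
    (h : k * Real.sin (k * l) = α * Real.cos (k * l)) :
    EvenMode l α (k ^ 2) (fun x => Real.cos (k * x)) := by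
  have hd : deriv (fun x => Real.cos (k * x)) = fun x => -k * Real.sin (k * x) := by
    funext x
    have := ((hasDerivAt_id x).const_mul k).cos
    simp only [id, mul_one] at this
    rw [this.deriv]; ring
  refine ⟨⟨by fun_prop, fun x => ?_, fun x hx hxl => ?_, ?_⟩, fun x => ?_, by simp, by simp [hd]⟩
  · rw [hd]
    have := (((hasDerivAt_id x).const_mul k).sin).const_mul (-k)
    simp only [id, mul_one] at this
    exact this.congr_deriv (by ring)
  · apply Real.cos_pos_of_mem_Ioo
    have := Real.pi_pos
    constructor <;> nlinarith [mul_pos hk hx]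
  · simp only [hd]; linarith
  · simp

theorem evenMode_cosh {l α k : ℝ} (h : k * Real.sinh (k * l) = -α * Real.cosh (k * l)) :
    EvenMode l α (-k ^ 2) (fun x => Real.cosh (k * x)) := by
  have hd : deriv (fun x => Real.cosh (k * x)) = fun x => k * Real.sinh (k * x) := by
    funext x
    have := ((hasDerivAt_id x).const_mul k).cosh
    simp only [id, mul_one] at this
    rw [this.deriv]; ring
  refine ⟨⟨by fun_prop, fun x => ?_, fun x hx hxl => Real.cosh_pos _, ?_⟩, fun x => ?_,
    by simp, by simp [hd]⟩
  · rw [hd]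
    have := (((hasDerivAt_id x).const_mul k).sinh).const_mul k
    simp only [id, mul_one] at this
    exact this.congr_deriv (by ring)
  · simp only [hd]; linarith
  · simp

theorem oddMode_sin {l α k : ℝ} (hk : 0 < k) (hkl : k * l < Real.pi)
    (h : k * Real.cos (k * l) = -α * Real.sin (k * l)) :
    OddMode l α (k ^ 2) (fun x => Real.sin (k * x)) := by
  have hd : deriv (fun x => Real.sin (k * x)) = fun x => k * Real.cos (k * x) := by
    funext x
    have := ((hasDerivAt_id x).const_mul k).sin
    simp only [id, mul_one] at this
    rw [this.deriv]; ring
  refine ⟨⟨by fun_prop, fun x => ?_, fun x hx hxl => ?_, ?_⟩, fun x => ?_, by simp,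
    by simpa [hd] using hk⟩
  · rw [hd]
    have := (((hasDerivAt_id x).const_mul k).cos).const_mul k
    simp only [id, mul_one] at this
    exact this.congr_deriv (by ring)
  · exact Real.sin_pos_of_pos_of_lt_pi (mul_pos hk hx) (by nlinarith)
  · simp only [hd]; linarith
  · simp

theorem oddMode_sinh {l α k : ℝ} (hk : 0 < k)
    (h : k * Real.cosh (k * l) = -α * Real.sinh (k * l)) :
    OddMode l α (-k ^ 2) (fun x => Real.sinh (k * x)) := by
  have hd : deriv (fun x => Real.sinh (k * x)) = fun x => k * Real.cosh (k * x) := by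
    funext x
    have := ((hasDerivAt_id x).const_mul k).sinh
    simp only [id, mul_one] at this
    rw [this.deriv]; ring
  refine ⟨⟨by fun_prop, fun x => ?_, fun x hx hxl => ?_, ?_⟩, fun x => ?_, by simp,
    by simpa [hd] using hk⟩
  · rw [hd]
    have := (((hasDerivAt_id x).const_mul k).cosh).const_mul k
    simp only [id, mul_one] at this
    exact this.congr_deriv (by ring)
  · exact Real.sinh_pos_iff.2 (mul_pos hk hx)
  · simp only [hd]; linarith
  · simp

theorem oddMode_id {l α : ℝ} (h : α * l = -1) : OddMode l α 0 (fun x => x) := by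
  have hd : deriv (fun x : ℝ => x) = fun _ => 1 := by funext x; simp
  refine ⟨⟨by fun_prop, fun x => ?_, fun x hx _ => hx, ?_⟩, fun x => rfl, rfl, by simp⟩
  · rw [hd]; simpa using hasDerivAt_const x (1 : ℝ)
  · simp only [hd]; linarith

theorem evenMode_one {l : ℝ} : EvenMode l 0 0 (fun _ => 1) := by
  have hd : deriv (fun _ : ℝ => (1 : ℝ)) = fun _ => 0 := by funext x; simp
  refine ⟨⟨by fun_prop, fun x => ?_, fun x _ _ => one_pos, ?_⟩, fun x => rfl, one_pos, by simp⟩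
  · rw [hd]; simpa using hasDerivAt_const x (0 : ℝ)
  · simp

/-- The sign of `α` selects `cosh`, `1` or `cos`; the frequency is a root of the Robin condition at
`l`, found by the intermediate value theorem. -/
theorem exists_evenMode {l : ℝ} (hl : 0 < l) (α : ℝ) : ∃ μ y, EvenMode l α μ y := by
  rcases lt_trichotomy α 0 with hα | rfl | hα
  · let g : ℝ → ℝ := fun k => k * Real.sinh (k * l) + α * Real.cosh (k * l)
    have hg : Continuous g := by fun_prop
    have hl' : 0 < 1 / l := by positivity
    -- At this endpoint `t = k * l ≥ 1`, hence `sinh t ≥ 1`. Writing `cosh t = sinh t + exp (-t)`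
    -- bounds `g` below by `(-α + 1 / l) + α = 1 / l > 0`.
    have hK : 0 ≤ -2 * α + 1 / l := by linarith
    obtain ⟨k, hk, hk0⟩ := intermediate_value_Icc hK hg.continuousOn
      (show (0 : ℝ) ∈ Set.Icc (g 0) (g (-2 * α + 1 / l)) by
        refine ⟨by simpa [g] using hα.le, ?_⟩
        set t := (-2 * α + 1 / l) * l with ht
        have ht1 : 1 ≤ t := by
          have : t = -2 * (α * l) + 1 := by rw [ht]; field_simp
          nlinarith
        have h1 : t ≤ Real.sinh t := Real.self_le_sinh_iff.2 (by linarith)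
        have h2 := Real.cosh_sub_sinh t
        have h3 : Real.exp (-t) ≤ 1 := Real.exp_le_one_iff.2 (by linarith)
        have h4 : (-α + 1 / l) * 1 ≤ (-α + 1 / l) * Real.sinh t :=
          mul_le_mul_of_nonneg_left (by linarith) (by linarith)
        simp only [g, ← ht]
        nlinarith)
    exact ⟨_, _, evenMode_cosh (k := k) (by simp only [g] at hk0; linarith)⟩
  · exact ⟨_, _, evenMode_one⟩
  · let g : ℝ → ℝ := fun k => k * Real.sin (k * l) - α * Real.cos (k * l)
    have hg : Continuous g := by fun_prop
    have hpi := Real.pi_pos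
    have hK : (0 : ℝ) < Real.pi / 2 / l := by positivity
    have hKl : Real.pi / 2 / l * l = Real.pi / 2 := by field_simp
    obtain ⟨k, hk, hk0⟩ := intermediate_value_Ioo hK.le hg.continuousOn
      (show (0 : ℝ) ∈ Set.Ioo (g 0) (g (Real.pi / 2 / l)) by
        simp only [g, hKl]; simp [hα, hK])
    refine ⟨_, _, evenMode_cos hk.1 ?_ (sub_eq_zero.1 hk0)⟩
    rw [← hKl]; exact mul_lt_mul_of_pos_right hk.2 hl

/-- The linear function is the mode exactly when `α * l = -1`, so the sign of `1 + α * l` decides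
between `sinh` and `sin`. -/
theorem exists_oddMode {l : ℝ} (hl : 0 < l) (α : ℝ) : ∃ μ y, OddMode l α μ y := by
  rcases lt_trichotomy (1 + α * l) 0 with hα | hα | hα
  · have hc : Continuous (dslope Real.sinh 0) := by
      rw [continuous_iff_continuousAt]
      intro x
      rcases eq_or_ne x 0 with rfl | hx
      · exact continuousAt_dslope_same.2 Real.differentiable_sinh.differentiableAt
      · exact (continuousAt_dslope_of_ne hx).2 Real.continuous_sinh.continuousAt
    -- The Robin condition in `t = k * l`, divided by `k`: `dslope Real.sinh 0 t` is `sinh t / t`,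
    -- with value `1` at `0`. The division removes the trivial root `t = 0`. At `t = -(α * l)` the
    -- value is `cosh t - sinh t > 0`.
    let g : ℝ → ℝ := fun t => Real.cosh t + α * l * dslope Real.sinh 0 t
    have hg : Continuous g := by fun_prop
    have hT : 0 < -(α * l) := by linarith
    obtain ⟨t, ht, ht0⟩ := intermediate_value_Ioo hT.le hg.continuousOn
      (show (0 : ℝ) ∈ Set.Ioo (g 0) (g (-(α * l))) by
        refine ⟨by simpa [g, dslope_same] using hα, ?_⟩
        simp only [g]
        rw [dslope_of_ne _ hT.ne', slope_def_field]
        have := Real.sinh_lt_cosh (-(α * l))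
        have hne : α * l ≠ 0 := by linarith
        rw [Real.sinh_zero, sub_zero, sub_zero, div_neg, mul_neg, mul_div_cancel₀ _ hne]
        linarith)
    have hk : 0 < t / l := div_pos ht.1 hl
    refine ⟨_, _, oddMode_sinh hk ?_⟩
    simp only [g] at ht0
    rw [dslope_of_ne _ ht.1.ne', slope_def_field, Real.sinh_zero, sub_zero, sub_zero] at ht0
    have ht' := ht.1.ne'
    rw [div_mul_cancel₀ _ hl.ne']
    field_simp at ht0 ⊢
    linarith
  · exact ⟨_, _, oddMode_id (by linarith)⟩
  · let g : ℝ → ℝ := fun t => Real.cos t + α * l * Real.sinc t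
    have hg : Continuous g := by
      have := Real.continuous_sinc
      fun_prop
    obtain ⟨t, ht, ht0⟩ := intermediate_value_Ioo' Real.pi_pos.le hg.continuousOn
      (show (0 : ℝ) ∈ Set.Ioo (g Real.pi) (g 0) by
        refine ⟨?_, by simpa [g] using hα⟩
        simp [g, Real.sinc_of_ne_zero Real.pi_ne_zero])
    have hk : 0 < t / l := div_pos ht.1 hl
    have ht' := ht.1.ne'
    refine ⟨_, _, oddMode_sin hk (by rw [div_mul_cancel₀ _ hl.ne']; exact ht.2) ?_⟩
    simp only [g] at ht0
    rw [Real.sinc_of_ne_zero ht'] at ht0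
    rw [div_mul_cancel₀ _ hl.ne']
    field_simp at ht0 ⊢
    linarith

/-! ### Wronskian comparison and supporting lines on the half-interval -/

namespace HalfMode

variable {l α β μ ν x : ℝ} {y z : ℝ → ℝ}

theorem hasDerivAt (h : HalfMode l α μ y) (x : ℝ) : HasDerivAt y (deriv y x) x :=
  (h.smooth.differentiable (by simp) x).hasDerivAt

theorem continuous (h : HalfMode l α μ y) : Continuous y := h.smooth.continuous

theorem continuous_deriv (h : HalfMode l α μ y) : Continuous (deriv y) :=
  h.smooth.continuous_deriv (by simp)

theorem hasDerivAt_wronskian (hy : HalfMode l α μ y) (hz : HalfMode l β ν z) (x : ℝ) :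
    HasDerivAt (fun x => y x * deriv z x - z x * deriv y x) ((μ - ν) * (y x * z x)) x := by
  refine (((hy.hasDerivAt x).mul (hz.ode x)).sub ((hz.hasDerivAt x).mul (hy.ode x))).congr_deriv ?_
  ring

theorem wronskian_eq (hy : HalfMode l α μ y) (hz : HalfMode l β ν z) (x : ℝ) :
    y x * deriv z x - z x * deriv y x - (y 0 * deriv z 0 - z 0 * deriv y 0)
      = (μ - ν) * ∫ t in 0..x, y t * z t := by
  rw [← intervalIntegral.integral_const_mul, intervalIntegral.integral_eq_sub_of_hasDerivAt
    (fun t _ => hy.hasDerivAt_wronskian hz t)]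
  have := hy.continuous
  have := hz.continuous
  exact Continuous.intervalIntegrable (by fun_prop) _ _

theorem integral_mul_pos (hy : HalfMode l α μ y) (hz : HalfMode l β ν z) (hx : 0 < x)
    (hxl : x ≤ l) : 0 < ∫ t in 0..x, y t * z t := by
  have := hy.continuous
  have := hz.continuous
  refine intervalIntegral.intervalIntegral_pos_of_pos_on
    (Continuous.intervalIntegrable (by fun_prop) _ _) (fun t ht => ?_) hx
  exact mul_pos (hy.pos t ht.1 (ht.2.le.trans hxl)) (hz.pos t ht.1 (ht.2.le.trans hxl))

/-- Two half modes with the same condition at `0`: the one with the larger Robin parameter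
decreases faster. -/
theorem mul_lt_mul_of_lt (hl : 0 < l) (hy : HalfMode l α μ y) (hz : HalfMode l β ν z)
    (h0 : y 0 * deriv z 0 - z 0 * deriv y 0 = 0) (hαβ : α < β) :
    μ < ν ∧ ∀ x ∈ Set.Ioo 0 l, z l * y x < z x * y l := by
  have hyl := hy.pos l hl le_rfl
  have hzl := hz.pos l hl le_rfl
  have hW : ∀ x, y x * deriv z x - z x * deriv y x = (μ - ν) * ∫ t in 0..x, y t * z t := by
    intro x
    rw [← hy.wronskian_eq hz, h0, sub_zero]
  have hlt : μ < ν := by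
    have h1 := hW l
    rw [hy.robin, hz.robin] at h1
    have h2 := hy.integral_mul_pos hz hl le_rfl
    have h3 : (μ - ν) * ∫ t in 0..l, y t * z t < 0 := by
      rw [← h1]
      nlinarith [mul_pos hyl hzl]
    by_contra h
    exact absurd h3 (not_lt.2 (mul_nonneg (by linarith) h2.le))
  refine ⟨hlt, fun x hx => ?_⟩
  -- The derivative of `z / y` is the Wronskian over `y²`, negative since `μ < ν`. The interval
  -- starts at `x > 0` because an odd `y` vanishes at `0`.
  have hanti : StrictAntiOn (fun t => z t / y t) (Set.Icc x l) := by
    have hpos : ∀ t ∈ Set.Icc x l, 0 < y t := fun t ht => hy.pos t (hx.1.trans_le ht.1) ht.2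
    have hder : ∀ t ∈ Set.Icc x l, HasDerivAt (fun t => z t / y t)
        ((deriv z t * y t - z t * deriv y t) / y t ^ 2) t := fun t ht =>
      (hz.hasDerivAt t).div (hy.hasDerivAt t) (hpos t ht).ne'
    refine strictAntiOn_of_deriv_neg (convex_Icc x l)
      (fun t ht => (hder t ht).continuousAt.continuousWithinAt) (fun t ht => ?_)
    rw [interior_Icc] at ht
    have ht' : t ∈ Set.Icc x l := ⟨ht.1.le, ht.2.le⟩
    rw [(hder t ht').deriv]
    refine div_neg_of_neg_of_pos ?_ (pow_pos (hpos t ht') 2)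
    have h1 := hW t
    have h2 := hy.integral_mul_pos hz (hx.1.trans ht.1) ht.2.le
    nlinarith
  have := hanti ⟨le_rfl, hx.2.le⟩ ⟨hx.2.le, le_rfl⟩ hx.2
  rwa [div_lt_div_iff₀ hyl (hy.pos x hx.1 hx.2.le)] at this

/-- Strict supporting line for the eigenvalue as a function of the Robin parameter. -/
theorem lt_supportingLine (hl : 0 < l) (hy : HalfMode l α μ y) (hz : HalfMode l β ν z)
    (h0 : y 0 * deriv z 0 - z 0 * deriv y 0 = 0) (hne : β ≠ α) :
    ν < μ + y l ^ 2 / (∫ t in 0..l, y t * y t) * (β - α) := by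
  have cy := hy.continuous
  have cz := hz.continuous
  have hyl := hy.pos l hl le_rfl
  have hzl := hz.pos l hl le_rfl
  have hI := hy.integral_mul_pos hy hl le_rfl
  have hW := hy.wronskian_eq hz l
  rw [h0, sub_zero, hy.robin, hz.robin] at hW
  set I := ∫ t in 0..l, y t * y t
  set J := ∫ t in 0..l, y t * z t
  have hJ : 0 < J := hy.integral_mul_pos hz hl le_rfl
  -- The pointwise comparison integrated against `y`; the sign `s = ±1` treats `α < β` and `β < α`
  -- together.
  have key : ∀ {s : ℝ}, (∀ x ∈ Set.Ioo 0 l, 0 < s * (z x * y l - z l * y x)) →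
      0 < s * (y l * J - z l * I) := by
    intro s hs
    have : s * (y l * J - z l * I)
        = ∫ t in 0..l, y t * (s * (z t * y l - z l * y t)) := by
      simp only [I, J]
      rw [← intervalIntegral.integral_const_mul, ← intervalIntegral.integral_const_mul,
        ← intervalIntegral.integral_sub, ← intervalIntegral.integral_const_mul]
      · congr 1; funext t; ring
      · exact Continuous.intervalIntegrable (by fun_prop) _ _
      · exact Continuous.intervalIntegrable (by fun_prop) _ _
    rw [this]
    refine intervalIntegral.intervalIntegral_pos_of_pos_on
      (Continuous.intervalIntegrable (by fun_prop) _ _) (fun t ht => ?_) hl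
    exact mul_pos (hy.pos t ht.1 ht.2.le) (hs t ht)
  -- Both factors have the sign of `β - α`, so in either order `(ν - μ) * z l * I < (ν - μ) * y l *
  -- J`, and the right side is known from the Wronskian identity.
  have hprod : 0 < (ν - μ) * (y l * J - z l * I) := by
    rcases lt_or_gt_of_ne hne with h | h
    · obtain ⟨h1, h2⟩ := hz.mul_lt_mul_of_lt hl hy (by linarith) h
      have := key (s := -1) (fun x hx => by have := h2 x hx; nlinarith)
      nlinarith
    · obtain ⟨h1, h2⟩ := hy.mul_lt_mul_of_lt hl hz h0 h
      have := key (s := 1) (fun x hx => by have := h2 x hx; nlinarith)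
      nlinarith
  have hW' : (ν - μ) * J = y l * z l * (β - α) := by linarith
  have h5 : (ν - μ) * I * z l < y l ^ 2 * (β - α) * z l := by
    have : y l * ((ν - μ) * J) = y l ^ 2 * (β - α) * z l := by rw [hW']; ring
    nlinarith
  have h6 := lt_of_mul_lt_mul_right h5 hzl.le
  have h7 : ν - μ < y l ^ 2 * (β - α) / I := (lt_div_iff₀ hI).2 h6
  rw [div_mul_eq_mul_div]
  linarith

end HalfMode

/-! ### Parity and the Wronskian of the even and odd modes -/

theorem EvenMode.deriv_neg {l α μ : ℝ} {y : ℝ → ℝ} (h : EvenMode l α μ y) (x : ℝ) :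
    deriv y (-x) = -deriv y x := by
  have : (fun x => y (-x)) = y := funext h.even
  have h2 := deriv_comp_neg y x
  rw [this] at h2
  linarith

theorem OddMode.deriv_neg {l α μ : ℝ} {y : ℝ → ℝ} (h : OddMode l α μ y) (x : ℝ) :
    deriv y (-x) = deriv y x := by
  have : (fun x => y (-x)) = fun x => -y x := funext h.odd
  have h2 := deriv_comp_neg y x
  rw [this, deriv.fun_neg] at h2
  linarith

theorem EvenMode.pos' {l α μ : ℝ} {y : ℝ → ℝ} (h : EvenMode l α μ y) {x : ℝ}
    (hx : x ∈ Set.Icc (-l) l) : 0 < y x := by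
  rcases lt_trichotomy x 0 with h0 | rfl | h0
  · rw [← h.even]; exact h.pos _ (by linarith) (by linarith [hx.1])
  · exact h.pos_zero
  · exact h.pos _ h0 hx.2

section Pair

variable {l α μ ν : ℝ} {y z : ℝ → ℝ}

/-- The odd mode has the larger eigenvalue. -/
theorem EvenMode.lt_of_oddMode (hl : 0 < l) (hy : EvenMode l α μ y) (hz : OddMode l α ν z) :
    μ < ν := by
  -- With equal Robin parameters the Wronskian vanishes at `l`, while at `0` it is `y 0 * deriv z 0
  -- > 0`; its increment is `(μ - ν) ∫ y z`.
  have h1 := hy.wronskian_eq hz.toHalfMode l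
  have h2 := hy.integral_mul_pos hz.toHalfMode hl le_rfl
  rw [hy.robin, hz.robin, hz.zero] at h1
  have h3 := mul_pos hy.pos_zero hz.deriv_zero_pos
  by_contra h
  nlinarith [mul_nonneg (sub_nonneg.2 (not_lt.1 h)) h2.le]

/-- Since the Wronskian vanishes at `l`, its value at `x ≥ 0` is `(ν - μ) ∫ y z` over `(x, l)`. It
is an even function, which covers `x < 0`. This positivity drives the Hardy inequality. -/
theorem EvenMode.wronskian_pos (hl : 0 < l) (hy : EvenMode l α μ y) (hz : OddMode l α ν z)
    {x : ℝ} (hx : x ∈ Set.Ioo (-l) l) : 0 < y x * deriv z x - z x * deriv y x := by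
  have hpos : ∀ x, 0 ≤ x → x < l → 0 < y x * deriv z x - z x * deriv y x := by
    intro x hx hxl
    have h1 := hy.wronskian_eq hz.toHalfMode l
    have h2 := hy.wronskian_eq hz.toHalfMode x
    have cy := hy.continuous
    have cz := hz.continuous
    have h3 : 0 < ∫ t in x..l, y t * z t := by
      refine intervalIntegral.intervalIntegral_pos_of_pos_on
        (Continuous.intervalIntegrable (by fun_prop) _ _) (fun t ht => ?_) hxl
      exact mul_pos (hy.pos t (hx.trans_lt ht.1) ht.2.le) (hz.pos t (hx.trans_lt ht.1) ht.2.le)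
    have h4 := intervalIntegral.integral_add_adjacent_intervals (μ := volume)
      (Continuous.intervalIntegrable (u := fun t => y t * z t) (by fun_prop) 0 x)
      (Continuous.intervalIntegrable (by fun_prop) x l)
    rw [hy.robin, hz.robin, ← h4] at h1
    have := hy.lt_of_oddMode hl hz
    nlinarith
  rcases le_total 0 x with h0 | h0
  · exact hpos x h0 hx.2
  · have := hpos (-x) (by linarith) (by linarith [hx.1])
    rw [hy.even, hy.deriv_neg, hz.odd, hz.deriv_neg] at this
    linarith

end Pair

/-! ### Robin modes on an arbitrary interval -/

/-- A smooth function on the line solving the Robin eigenvalue problem on `(a, b)`. -/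
structure RobinMode (a b α μ : ℝ) (y : ℝ → ℝ) : Prop where
  smooth : ContDiff ℝ ∞ y
  ode : ∀ x, HasDerivAt (deriv y) (-μ * y x) x
  robin_left : deriv y a = α * y a
  robin_right : deriv y b = -α * y b

namespace RobinMode

variable {a b α μ : ℝ} {y : ℝ → ℝ}

theorem hasDerivAt (h : RobinMode a b α μ y) (x : ℝ) : HasDerivAt y (deriv y x) x :=
  (h.smooth.differentiable (by simp) x).hasDerivAt

theorem continuous (h : RobinMode a b α μ y) : Continuous y := h.smooth.continuous

theorem continuous_deriv (h : RobinMode a b α μ y) : Continuous (deriv y) :=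
  h.smooth.continuous_deriv (by simp)

theorem const_mul (h : RobinMode a b α μ y) (c : ℝ) :
    RobinMode a b α μ (fun x => c * y x) := by
  have hd : deriv (fun x => c * y x) = fun x => c * deriv y x := by
    funext x; exact ((h.hasDerivAt x).const_mul c).deriv
  refine ⟨contDiff_const.mul h.smooth, fun x => ?_, ?_, ?_⟩
  · rw [hd]; exact ((h.ode x).const_mul c).congr_deriv (by ring)
  · simp only [hd, h.robin_left]; ring
  · simp only [hd, h.robin_right]; ring

end RobinMode

/-- Integral comparison up to an exact derivative. -/
theorem integral_add_sub_le {a b : ℝ} (hab : a ≤ b) {A B G g : ℝ → ℝ}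
    (hA : ContinuousOn A (Set.Icc a b)) (hB : ContinuousOn B (Set.Icc a b))
    (hG : ∀ x ∈ Set.Icc a b, HasDerivAt G (g x) x) (hg : ContinuousOn g (Set.Icc a b))
    (h : ∀ x ∈ Set.Icc a b, B x + g x ≤ A x) :
    (∫ x in a..b, B x) + (G b - G a) ≤ ∫ x in a..b, A x := by
  rw [← Set.uIcc_of_le hab] at hA hB hG hg
  rw [← intervalIntegral.integral_eq_sub_of_hasDerivAt hG hg.intervalIntegrable,
    ← intervalIntegral.integral_add hB.intervalIntegrable hg.intervalIntegrable]
  exact intervalIntegral.integral_mono_on hab (hB.add hg).intervalIntegrable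
    hA.intervalIntegrable h

/-! ### The one-dimensional spectral gap inequality -/

section Gap

variable {a b α μ ν : ℝ} {φ ψ : ℝ → ℝ}

/-- Weighted Hardy inequality associated with two modes. -/
theorem hardy (hab : a < b) (hφ : RobinMode a b α μ φ) (hψ : RobinMode a b α ν ψ)
    (hφpos : ∀ x ∈ Set.Icc a b, 0 < φ x) (hμν : μ < ν)
    (hK : ∀ x ∈ Set.Ioo a b, 0 < φ x * deriv ψ x - ψ x * deriv φ x)
    {F F' : ℝ → ℝ} (hF : ∀ x, HasDerivAt F (F' x) x) (hF' : Continuous F')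
    (ha : F a = 0) (hb : F b = 0) :
    (ν - μ) * ∫ x in a..b, F x ^ 2 / φ x ^ 2 ≤ ∫ x in a..b, F' x ^ 2 / φ x ^ 2 := by
  have cφ := hφ.continuous
  have cψ := hψ.continuous
  have cφ' := hφ.continuous_deriv
  have cψ' := hψ.continuous_deriv
  have cF : Continuous F := continuous_iff_continuousAt.2 fun x => (hF x).continuousAt
  -- From `K' = (μ - ν) φ ψ` and `(ψ / φ)' = K / φ²` one gets `-(K' / φ²)' = (ν - μ) K / φ²`. Thus
  -- `K` is a positive Dirichlet solution for the weight `1 / φ²`, with eigenvalue exactly the gap.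
  set K : ℝ → ℝ := fun x => φ x * deriv ψ x - ψ x * deriv φ x with hKdef
  have cK : Continuous K := by fun_prop
  have hK' : ∀ x, HasDerivAt K ((μ - ν) * (φ x * ψ x)) x := fun x =>
    (((hφ.hasDerivAt x).mul (hψ.ode x)).sub ((hψ.hasDerivAt x).mul (hφ.ode x))).congr_deriv
      (by ring)
  have hK0 : ∀ x ∈ Set.Icc a b, 0 ≤ K x := by
    intro x hx
    rcases eq_or_lt_of_le hx.1 with rfl | h1
    · simp only [hKdef, hφ.robin_left, hψ.robin_left]; apply le_of_eq; ring
    rcases eq_or_lt_of_le hx.2 with rfl | h2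
    · simp only [hKdef, hφ.robin_right, hψ.robin_right]; apply le_of_eq; ring
    exact (hK x ⟨h1, h2⟩).le
  -- The classical argument expands the square of `F' / φ - F K' / (φ K)`. Because `K` vanishes at
  -- both endpoints, the denominator is regularised to `K + ε`; then `ε → 0` by dominated
  -- convergence.
  have hε : ∀ ε : ℝ, 0 < ε → ∫ x in a..b, (ν - μ) * (F x ^ 2 / φ x ^ 2 * (K x / (K x + ε)))
      ≤ ∫ x in a..b, F' x ^ 2 / φ x ^ 2 := by
    intro ε hε
    have hKε : ∀ x ∈ Set.Icc a b, K x + ε ≠ 0 := fun x hx => by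
      have := hK0 x hx; positivity
    have hφ0 : ∀ x ∈ Set.Icc a b, φ x ≠ 0 := fun x hx => (hφpos x hx).ne'
    have key := integral_add_sub_le hab.le
      (A := fun x => F' x ^ 2 / φ x ^ 2)
      (B := fun x => (ν - μ) * (F x ^ 2 / φ x ^ 2 * (K x / (K x + ε))))
      (G := fun x => F x ^ 2 * ((μ - ν) * (ψ x / (φ x * (K x + ε)))))
      (g := fun x => 2 * F x * F' x * ((μ - ν) * (ψ x / (φ x * (K x + ε))))
        + F x ^ 2 * ((μ - ν) * ((deriv ψ x * (φ x * (K x + ε))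
            - ψ x * (deriv φ x * (K x + ε) + φ x * ((μ - ν) * (φ x * ψ x))))
              / (φ x * (K x + ε)) ^ 2)))
      (by
        refine ContinuousOn.div (by fun_prop) (by fun_prop) fun x hx => ?_
        exact pow_ne_zero _ (hφ0 x hx))
      (by
        refine continuousOn_const.mul (ContinuousOn.mul (ContinuousOn.div (by fun_prop)
          (by fun_prop) fun x hx => ?_) (ContinuousOn.div (by fun_prop) (by fun_prop) hKε))
        exact pow_ne_zero _ (hφ0 x hx))
      (by
        intro x hx
        have h1 : HasDerivAt (fun x => K x + ε) ((μ - ν) * (φ x * ψ x)) x := (hK' x).add_const ε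
        refine (((hF x).pow 2).mul (((hψ.hasDerivAt x).div ((hφ.hasDerivAt x).mul h1)
          (mul_ne_zero (hφ0 x hx) (hKε x hx))).const_mul (μ - ν))).congr_deriv ?_
        simp)
      (by
        refine ContinuousOn.add (ContinuousOn.mul (by fun_prop) (continuousOn_const.mul
          (ContinuousOn.div (by fun_prop) (by fun_prop) fun x hx => ?_)))
          (ContinuousOn.mul (by fun_prop) (continuousOn_const.mul
          (ContinuousOn.div (by fun_prop) (by fun_prop) fun x hx => ?_)))
        · exact mul_ne_zero (hφ0 x hx) (hKε x hx)
        · exact pow_ne_zero _ (mul_ne_zero (hφ0 x hx) (hKε x hx)))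
      (by
        intro x hx
        rw [← sub_nonneg]
        have e : K x = φ x * deriv ψ x - ψ x * deriv φ x := rfl
        have h1 := hφ0 x hx
        have h2 := hKε x hx
        refine le_of_le_of_eq
          (sq_nonneg (F' x / φ x - F x * ((μ - ν) * (ψ x / (K x + ε))))) ?_
        generalize K x + ε = κ at h2
        rw [e]
        field_simp
        ring)
    simpa [ha, hb] using key
  have hlim : Tendsto (fun ε : ℝ => ∫ x in a..b,
      (ν - μ) * (F x ^ 2 / φ x ^ 2 * (K x / (K x + ε)))) (𝓝[>] 0)
      (𝓝 (∫ x in a..b, (ν - μ) * (F x ^ 2 / φ x ^ 2))) := by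
    refine intervalIntegral.tendsto_integral_filter_of_dominated_convergence
      (fun x => (ν - μ) * (F x ^ 2 / φ x ^ 2)) ?_ ?_ ?_ ?_
    · refine Eventually.of_forall fun ε => Measurable.aestronglyMeasurable ?_
      have := cF.measurable
      have := cφ.measurable
      have := cK.measurable
      fun_prop
    · filter_upwards [self_mem_nhdsWithin] with ε (hε : 0 < ε)
      refine Eventually.of_forall fun x hx => ?_
      rw [Set.uIoc_of_le hab.le] at hx
      have h1 := hK0 x ⟨hx.1.le, hx.2⟩
      have h2 : K x / (K x + ε) ≤ 1 := div_le_one_of_le₀ (by linarith) (by linarith)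
      have h3 : 0 ≤ K x / (K x + ε) := by positivity
      have h4 : 0 ≤ F x ^ 2 / φ x ^ 2 := by positivity
      rw [Real.norm_of_nonneg (mul_nonneg (by linarith) (mul_nonneg h4 h3))]
      exact mul_le_mul_of_nonneg_left (mul_le_of_le_one_right h4 h2) (by linarith)
    · refine ContinuousOn.intervalIntegrable ?_
      rw [Set.uIcc_of_le hab.le]
      refine continuousOn_const.mul (ContinuousOn.div (by fun_prop) (by fun_prop) fun x hx => ?_)
      exact pow_ne_zero _ (hφpos x hx).ne'
    · have hbne : ∀ᵐ x ∂(volume : Measure ℝ), x ≠ b := by simp [ae_iff]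
      filter_upwards [hbne] with x hxb hx
      rw [Set.uIoc_of_le hab.le] at hx
      have hKx : 0 < K x := hK x ⟨hx.1, lt_of_le_of_ne hx.2 hxb⟩
      have h1 : Tendsto (fun ε : ℝ => K x / (K x + ε)) (𝓝[>] 0) (𝓝 (K x / (K x + 0))) := by
        refine Tendsto.mono_left ?_ nhdsWithin_le_nhds
        refine ContinuousAt.div (by fun_prop) (by fun_prop) (by simpa using hKx.ne')
      rw [add_zero, div_self hKx.ne'] at h1
      simpa using (h1.const_mul (F x ^ 2 / φ x ^ 2)).const_mul (ν - μ)
  rw [← intervalIntegral.integral_const_mul]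
  exact le_of_tendsto hlim (by filter_upwards [self_mem_nhdsWithin] with ε h using hε ε h)

/-- Factorisation of the Robin form by the ground state. -/
theorem integral_sub_sq_eq (hab : a < b) (hφ : RobinMode a b α μ φ)
    (hφpos : ∀ x ∈ Set.Icc a b, 0 < φ x)
    {f f' : ℝ → ℝ} (hf : ∀ x, HasDerivAt f (f' x) x) (hf' : Continuous f') :
    ∫ x in a..b, (f' x - deriv φ x / φ x * f x) ^ 2
      = (∫ x in a..b, f' x ^ 2) + α * (f a ^ 2 + f b ^ 2) - μ * ∫ x in a..b, f x ^ 2 := by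
  have cφ := hφ.continuous
  have cφ' := hφ.continuous_deriv
  have cf : Continuous f := continuous_iff_continuousAt.2 fun x => (hf x).continuousAt
  have hφ0 : ∀ x ∈ Set.Icc a b, φ x ≠ 0 := fun x hx => (hφpos x hx).ne'
  -- `g` is the derivative of `(φ' / φ) f²`. Its boundary values produce the `α` terms, as `φ' / φ`
  -- equals `α` at `a` and `-α` at `b`.
  set g : ℝ → ℝ := fun x => (-μ * φ x * φ x - deriv φ x * deriv φ x) / φ x ^ 2 * f x ^ 2
    + deriv φ x / φ x * (2 * f x * f' x) with hg
  have hder : ∀ x ∈ Set.uIcc a b,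
      HasDerivAt (fun x => deriv φ x / φ x * f x ^ 2) (g x) x := by
    intro x hx
    rw [Set.uIcc_of_le hab.le] at hx
    refine (((hφ.ode x).div (hφ.hasDerivAt x) (hφ0 x hx)).mul ((hf x).pow 2)).congr_deriv ?_
    simp [hg]
  have cg : IntervalIntegrable g volume a b := by
    refine ContinuousOn.intervalIntegrable ?_
    rw [Set.uIcc_of_le hab.le]
    refine ContinuousOn.add (ContinuousOn.mul (ContinuousOn.div (by fun_prop) (by fun_prop)
      fun x hx => pow_ne_zero _ (hφ0 x hx)) (by fun_prop))
      (ContinuousOn.mul (ContinuousOn.div (by fun_prop) (by fun_prop) hφ0) (by fun_prop))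
  have hI := intervalIntegral.integral_eq_sub_of_hasDerivAt hder cg
  have i1 : IntervalIntegrable (fun x => f' x ^ 2) volume a b :=
    Continuous.intervalIntegrable (by fun_prop) _ _
  have i2 : IntervalIntegrable (fun x => μ * f x ^ 2) volume a b :=
    Continuous.intervalIntegrable (by fun_prop) _ _
  have e : ∫ x in a..b, (f' x - deriv φ x / φ x * f x) ^ 2
      = ∫ x in a..b, (f' x ^ 2 - g x - μ * f x ^ 2) := by
    refine intervalIntegral.integral_congr fun x hx => ?_
    rw [Set.uIcc_of_le hab.le] at hx
    have := hφ0 x hx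
    simp only [hg]
    field_simp
    ring
  rw [e, intervalIntegral.integral_sub (i1.sub cg) i2, intervalIntegral.integral_sub i1 cg, hI,
    intervalIntegral.integral_const_mul, hφ.robin_left, hφ.robin_right]
  have h1 := hφ0 a ⟨le_rfl, hab.le⟩
  have h2 := hφ0 b ⟨hab.le, le_rfl⟩
  field_simp
  ring

/-- Spectral gap inequality on an interval. -/
theorem gap_le (hab : a < b) (hφ : RobinMode a b α μ φ) (hψ : RobinMode a b α ν ψ)
    (hφpos : ∀ x ∈ Set.Icc a b, 0 < φ x) (hμν : μ < ν)
    (hK : ∀ x ∈ Set.Ioo a b, 0 < φ x * deriv ψ x - ψ x * deriv φ x)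
    (hnorm : ∫ x in a..b, φ x ^ 2 = 1)
    {f f' : ℝ → ℝ} (hf : ∀ x, HasDerivAt f (f' x) x) (hf' : Continuous f') :
    (ν - μ) * ((∫ x in a..b, f x ^ 2) - (∫ x in a..b, f x * φ x) ^ 2)
      ≤ (∫ x in a..b, f' x ^ 2) + α * (f a ^ 2 + f b ^ 2) - μ * ∫ x in a..b, f x ^ 2 := by
  have cφ := hφ.continuous
  have cφ' := hφ.continuous_deriv
  have cf : Continuous f := continuous_iff_continuousAt.2 fun x => (hf x).continuousAt
  have hφ0 : ∀ x ∈ Set.Icc a b, φ x ≠ 0 := fun x hx => (hφpos x hx).ne'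
  rw [← integral_sub_sq_eq hab hφ hφpos hf hf']
  set c := ∫ x in a..b, f x * φ x with hc
  set f₀ : ℝ → ℝ := fun x => f x - c * φ x with hf₀
  have cf₀ : Continuous f₀ := by fun_prop
  set d : ℝ → ℝ := fun x => f' x - deriv φ x / φ x * f x with hd
  have cd : ContinuousOn d (Set.Icc a b) :=
    ContinuousOn.sub (by fun_prop) (ContinuousOn.mul (ContinuousOn.div (by fun_prop) (by fun_prop)
      hφ0) (by fun_prop))
  have i1 : IntervalIntegrable (fun x => f x ^ 2) volume a b :=
    Continuous.intervalIntegrable (by fun_prop) _ _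
  have i2 : IntervalIntegrable (fun x => 2 * c * (f x * φ x)) volume a b :=
    Continuous.intervalIntegrable (by fun_prop) _ _
  have i3 : IntervalIntegrable (fun x => c ^ 2 * φ x ^ 2) volume a b :=
    Continuous.intervalIntegrable (by fun_prop) _ _
  have hX : ∫ x in a..b, f₀ x ^ 2 = (∫ x in a..b, f x ^ 2) - c ^ 2 := by
    have : ∀ x, f₀ x ^ 2 = f x ^ 2 - 2 * c * (f x * φ x) + c ^ 2 * φ x ^ 2 := fun x => by
      simp only [hf₀]; ring
    simp only [this]
    rw [intervalIntegral.integral_add (i1.sub i2) i3, intervalIntegral.integral_sub i1 i2,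
      intervalIntegral.integral_const_mul, intervalIntegral.integral_const_mul, hnorm, ← hc]
    ring
  have horth : ∫ x in a..b, f₀ x * φ x = 0 := by
    have : ∀ x, f₀ x * φ x = f x * φ x - c * φ x ^ 2 := fun x => by
      simp only [hf₀]; ring
    simp only [this]
    rw [intervalIntegral.integral_sub (Continuous.intervalIntegrable (by fun_prop) _ _)
      (Continuous.intervalIntegrable (by fun_prop) _ _),
      intervalIntegral.integral_const_mul, hnorm, ← hc]
    ring
  -- Orthogonality of `f₀` to `φ` makes this primitive vanish at both ends, so Hardy's inequality
  -- gives `(ν - μ) ∫ F² / φ² ≤ ∫ f₀²`.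
  set F : ℝ → ℝ := fun x => ∫ t in a..x, f₀ t * φ t with hFdef
  have hF : ∀ x, HasDerivAt F (f₀ x * φ x) x := fun x =>
    intervalIntegral.integral_hasDerivAt_right (Continuous.intervalIntegrable (by fun_prop) _ _)
      (Continuous.stronglyMeasurableAtFilter (by fun_prop) _ _) (by fun_prop)
  have cF : Continuous F := continuous_iff_continuousAt.2 fun x => (hF x).continuousAt
  have hFa : F a = 0 := by simp [hFdef]
  have hFb : F b = 0 := horth
  have hH := hardy hab hφ hψ hφpos hμν hK hF (by fun_prop) hFa hFb
  have e : ∫ x in a..b, (f₀ x * φ x) ^ 2 / φ x ^ 2 = ∫ x in a..b, f₀ x ^ 2 := by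
    refine intervalIntegral.integral_congr fun x hx => ?_
    rw [Set.uIcc_of_le hab.le] at hx
    have := hφ0 x hx
    field_simp
  rw [e, hX] at hH
  rw [← hX] at hH ⊢
  set γ := ν - μ with hγ
  have hγ0 : 0 < γ := sub_pos.2 hμν
  -- Since `(f₀ / φ)' = d / φ`, integration by parts gives `∫ f₀² = -∫ F d / φ`. Expanding `(d + γ F
  -- / φ)² ≥ 0` therefore yields `∫ d² ≥ 2 γ ∫ f₀² - γ² ∫ F² / φ²`, and Hardy bounds the last term
  -- by `γ ∫ f₀²`.
  have key := integral_add_sub_le hab.le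
    (A := fun x => d x ^ 2)
    (B := fun x => 2 * γ * f₀ x ^ 2 - γ ^ 2 * (F x ^ 2 / φ x ^ 2))
    (G := fun x => -2 * γ * (F x * (f₀ x / φ x)))
    (g := fun x => -2 * γ * (f₀ x * φ x * (f₀ x / φ x) + F x * (d x / φ x)))
    (by fun_prop)
    (by
      refine ContinuousOn.sub (by fun_prop) (continuousOn_const.mul (ContinuousOn.div (by fun_prop)
        (by fun_prop) fun x hx => pow_ne_zero _ (hφ0 x hx))))
    (by
      intro x hx
      have h0 := hφ0 x hx
      refine (((hF x).mul (((hf x).sub ((hφ.hasDerivAt x).const_mul c)).div (hφ.hasDerivAt x)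
        h0)).const_mul (-2 * γ)).congr_deriv ?_
      simp only [hd, hf₀, Pi.div_apply, Pi.sub_apply]
      field_simp
      ring)
    (by
      refine continuousOn_const.mul (ContinuousOn.add (ContinuousOn.mul (by fun_prop)
        (ContinuousOn.div (by fun_prop) (by fun_prop) hφ0)) (ContinuousOn.mul (by fun_prop)
        (ContinuousOn.div cd (by fun_prop) hφ0))))
    (by
      intro x hx
      have h0 := hφ0 x hx
      rw [← sub_nonneg]
      refine le_of_le_of_eq (sq_nonneg (d x + γ * (F x / φ x))) ?_
      field_simp
      ring)
  have i4 : IntervalIntegrable (fun x => 2 * γ * f₀ x ^ 2) volume a b :=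
    Continuous.intervalIntegrable (by fun_prop) _ _
  have i5 : IntervalIntegrable (fun x => γ ^ 2 * (F x ^ 2 / φ x ^ 2)) volume a b := by
    refine ContinuousOn.intervalIntegrable ?_
    rw [Set.uIcc_of_le hab.le]
    exact continuousOn_const.mul (ContinuousOn.div (by fun_prop)
        (by fun_prop) fun x hx => pow_ne_zero _ (hφ0 x hx))
  rw [hFa, hFb, intervalIntegral.integral_sub i4 i5, intervalIntegral.integral_const_mul,
    intervalIntegral.integral_const_mul] at key
  have hγ2 := mul_le_mul_of_nonneg_left hH hγ0.le
  nlinarith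

end Gap

/-! ### The two lowest levels of an interval, for all Robin parameters -/

theorem HalfMode.shift {a b α μ : ℝ} {y : ℝ → ℝ} (h : HalfMode ((b - a) / 2) α μ y)
    (hrefl : deriv y (-((b - a) / 2)) = α * y (-((b - a) / 2))) :
    RobinMode a b α μ (fun x => y (x - (a + b) / 2)) := by
  have hd : deriv (fun x => y (x - (a + b) / 2)) = fun x => deriv y (x - (a + b) / 2) := by
    funext x
    exact ((h.hasDerivAt _).comp_sub_const x ((a + b) / 2)).deriv
  have ha : a - (a + b) / 2 = -((b - a) / 2) := by ring
  have hb : b - (a + b) / 2 = (b - a) / 2 := by ring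
  refine ⟨h.smooth.comp (contDiff_id.sub contDiff_const), fun x => ?_, ?_, ?_⟩
  · rw [hd]; exact (h.ode _).comp_sub_const x ((a + b) / 2)
  · simp only [hd, ha, hrefl]
  · simp only [hd, hb, h.robin]

/-- The data of the lowest two Robin eigenvalues of an interval, for all parameters. -/
structure IntervalSpectrum (a b : ℝ) where
  μ : ℝ → ℝ
  ν : ℝ → ℝ
  φ : ℝ → ℝ → ℝ
  ψ : ℝ → ℝ → ℝ
  mode_φ : ∀ α, RobinMode a b α (μ α) (φ α)
  mode_ψ : ∀ α, RobinMode a b α (ν α) (ψ α)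
  φ_norm : ∀ α, ∫ x in a..b, φ α x ^ 2 = 1
  ψ_norm : ∀ α, 0 < ∫ x in a..b, ψ α x ^ 2
  lt : ∀ α, μ α < ν α
  μ_support : ∀ α, ∃ s, ∀ β, β ≠ α → μ β < μ α + s * (β - α)
  ν_support : ∀ α, ∃ s, ∀ β, β ≠ α → ν β < ν α + s * (β - α)
  gap : ∀ α (f f' : ℝ → ℝ), (∀ x, HasDerivAt f (f' x) x) → Continuous f' →
    (ν α - μ α) * ((∫ x in a..b, f x ^ 2) - (∫ x in a..b, f x * φ α x) ^ 2)
      ≤ (∫ x in a..b, f' x ^ 2) + α * (f a ^ 2 + f b ^ 2) - μ α * ∫ x in a..b, f x ^ 2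

theorem nonempty_intervalSpectrum {a b : ℝ} (hab : a < b) : Nonempty (IntervalSpectrum a b) := by
  set l := (b - a) / 2 with hl_def
  set m := (a + b) / 2 with hm_def
  have hl : 0 < l := by rw [hl_def]; linarith
  choose μ y hy using fun α => exists_evenMode hl α
  choose ν z hz using fun α => exists_oddMode hl α
  have hφ : ∀ α, RobinMode a b α (μ α) (fun x => y α (x - m)) := fun α =>
    (hy α).shift (by rw [(hy α).deriv_neg, (hy α).even, (hy α).robin]; ring)
  have hψ : ∀ α, RobinMode a b α (ν α) (fun x => z α (x - m)) := fun α =>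
    (hz α).shift (by rw [(hz α).deriv_neg, (hz α).odd, (hz α).robin]; ring)
  have hsub : ∀ {x}, x ∈ Set.Icc a b → x - m ∈ Set.Icc (-l) l := fun {x} hx => by
    rw [hl_def, hm_def]; constructor <;> linarith [hx.1, hx.2]
  have hsub' : ∀ {x}, x ∈ Set.Ioo a b → x - m ∈ Set.Ioo (-l) l := fun {x} hx => by
    rw [hl_def, hm_def]; constructor <;> linarith [hx.1, hx.2]
  have hφpos : ∀ α, ∀ x ∈ Set.Icc a b, 0 < y α (x - m) := fun α x hx => (hy α).pos' (hsub hx)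
  have hN : ∀ α, 0 < ∫ x in a..b, y α (x - m) ^ 2 := fun α => by
    have := (hφ α).continuous
    exact intervalIntegral.intervalIntegral_pos_of_pos_on
      ((this.pow 2).intervalIntegrable _ _)
      (fun x hx => pow_pos (hφpos α x ⟨hx.1.le, hx.2.le⟩) 2) hab
  set N : ℝ → ℝ := fun α => (Real.sqrt (∫ x in a..b, y α (x - m) ^ 2))⁻¹ with hN_def
  have hNpos : ∀ α, 0 < N α := fun α => inv_pos.2 (Real.sqrt_pos.2 (hN α))
  have hmode : ∀ α, RobinMode a b α (μ α) (fun x => N α * y α (x - m)) := fun α =>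
    (hφ α).const_mul (N α)
  have hnorm : ∀ α, ∫ x in a..b, (N α * y α (x - m)) ^ 2 = 1 := fun α => by
    simp only [mul_pow]
    rw [intervalIntegral.integral_const_mul, hN_def, inv_pow, Real.sq_sqrt (hN α).le,
      inv_mul_cancel₀ (hN α).ne']
  refine ⟨⟨μ, ν, fun α x => N α * y α (x - m), fun α x => z α (x - m), hmode, hψ, hnorm,
    fun α => ?_, fun α => (hy α).lt_of_oddMode hl (hz α),
    fun α => ⟨_, fun β hβ => (hy α).lt_supportingLine hl (hy β).toHalfMode ?_ hβ⟩,
    fun α => ⟨_, fun β hβ => (hz α).lt_supportingLine hl (hz β).toHalfMode ?_ hβ⟩,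
    fun α f f' hf hf' => ?_⟩⟩
  -- The odd mode changes sign, so only its right half, where it is positive, is used for strict
  -- positivity.
  · have hc := (hψ α).continuous
    have hi : ∀ c d, IntervalIntegrable (fun x => z α (x - m) ^ 2) volume c d := fun c d =>
      (hc.pow 2).intervalIntegrable _ _
    have hmb : m < b := by rw [hm_def]; linarith
    have ham : a ≤ m := by rw [hm_def]; linarith
    rw [← intervalIntegral.integral_add_adjacent_intervals (hi a m) (hi m b)]
    refine add_pos_of_nonneg_of_pos
      (intervalIntegral.integral_nonneg ham fun x _ => sq_nonneg _) ?_
    refine intervalIntegral.intervalIntegral_pos_of_pos_on (hi _ _) (fun x hx => ?_) hmb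
    refine pow_pos ((hz α).pos _ (by linarith [hx.1]) ?_) 2
    rw [hl_def, hm_def]; linarith [hx.2]
  · rw [(hy α).deriv_zero, (hy β).deriv_zero]; ring
  · rw [(hz α).zero, (hz β).zero]; ring
  · refine gap_le hab (hmode α) (hψ α) (fun x hx => mul_pos (hNpos α) (hφpos α x hx))
      ((hy α).lt_of_oddMode hl (hz α)) (fun x hx => ?_) (hnorm α) hf hf'
    have h1 : deriv (fun x => N α * y α (x - m)) x = N α * deriv (y α) (x - m) :=
      ((((hy α).hasDerivAt _).comp_sub_const x m).const_mul (N α)).deriv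
    have h2 : deriv (fun x => z α (x - m)) x = deriv (z α) (x - m) :=
      (((hz α).hasDerivAt _).comp_sub_const x m).deriv
    rw [h1, h2]
    have := mul_pos (hNpos α) ((hy α).wronskian_pos hl (hz α) (hsub' hx))
    linarith

/-- A function with a strict supporting line at every point is strictly concave. -/
theorem strictConcaveOn_of_support {f : ℝ → ℝ}
    (h : ∀ α, ∃ s, ∀ β, β ≠ α → f β < f α + s * (β - α)) : StrictConcaveOn ℝ Set.univ f := by
  refine ⟨convex_univ, fun x _ y _ hxy p q hp hq hpq => ?_⟩
  simp only [smul_eq_mul]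
  obtain ⟨s, hs⟩ := h (p * x + q * y)
  have hq' : q = 1 - p := by linarith
  have hx : x - (p * x + q * y) = q * (x - y) := by rw [hq']; ring
  have hy : y - (p * x + q * y) = -p * (x - y) := by rw [hq']; ring
  have h1 := hs x (fun h => by
    rw [← sub_eq_zero, hx] at h
    exact mul_ne_zero hq.ne' (sub_ne_zero.2 hxy) h)
  have h2 := hs y (fun h => by
    rw [← sub_eq_zero, hy] at h
    exact mul_ne_zero (neg_ne_zero.2 hp.ne') (sub_ne_zero.2 hxy) h)
  rw [hx] at h1
  rw [hy] at h2
  have h3 := mul_lt_mul_of_pos_left h1 hp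
  have h4 := mul_lt_mul_of_pos_left h2 hq
  have h5 : (p + q) * f (p * x + q * y) = f (p * x + q * y) := by rw [hpq, one_mul]
  nlinarith

section

variable {n : ℕ}

/-! ### Slicing of product measures -/

theorem isFiniteMeasure_update {μ : Fin n → Measure ℝ} [∀ j, IsFiniteMeasure (μ j)] (i : Fin n)
    (ρ : Measure ℝ) [IsFiniteMeasure ρ] (j : Fin n) :
    IsFiniteMeasure (Function.update μ i ρ j) := by
  rcases eq_or_ne j i with rfl | h
  · rw [Function.update_self]; infer_instance
  · rw [Function.update_of_ne h]; infer_instance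

/-- Overwriting the `i`-th coordinate forgets the probability measure `τ` placed there. With a Dirac
mass for `τ`, a face parametrises the lines parallel to axis `i`, so Fubini can stay inside `Fin n →
ℝ` without splitting off a coordinate. -/
theorem pi_update_eq_map (μ : Fin n → Measure ℝ) [∀ j, IsFiniteMeasure (μ j)] (i : Fin n)
    (ρ τ : Measure ℝ) [IsFiniteMeasure ρ] [IsProbabilityMeasure τ] :
    Measure.pi (Function.update μ i ρ)
      = ((Measure.pi (Function.update μ i τ)).prod ρ).map
          (fun p => Function.update p.1 i p.2) := by
  have h1 := isFiniteMeasure_update (μ := μ) i ρ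
  have h2 := isFiniteMeasure_update (μ := μ) i τ
  refine Measure.pi_eq fun s hs => ?_
  have hm : Measurable (fun p : (Fin n → ℝ) × ℝ => Function.update p.1 i p.2) :=
    (continuous_fst.update i continuous_snd).measurable
  have hpre : (fun p : (Fin n → ℝ) × ℝ => Function.update p.1 i p.2) ⁻¹' (Set.univ.pi s)
      = (Set.univ.pi (Function.update s i Set.univ)) ×ˢ s i := by
    ext p
    simp only [Set.mem_preimage, Set.mem_univ_pi, Set.mem_prod]
    constructor
    · refine fun h => ⟨fun j => ?_, by simpa using h i⟩
      rcases eq_or_ne j i with rfl | hj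
      · simp
      · simpa [hj] using h j
    · rintro ⟨h, h'⟩ j
      rcases eq_or_ne j i with rfl | hj
      · simpa using h'
      · simpa [hj] using h j
  rw [Measure.map_apply hm (MeasurableSet.univ_pi hs), hpre, Measure.prod_prod, Measure.pi_pi,
    ← Finset.mul_prod_erase Finset.univ _ (Finset.mem_univ i),
    ← Finset.mul_prod_erase Finset.univ _ (Finset.mem_univ i)]
  simp only [Function.update_self, measure_univ, one_mul]
  rw [mul_comm]
  congr 1
  refine Finset.prod_congr rfl fun j hj => ?_
  rw [Function.update_of_ne (Finset.ne_of_mem_erase hj),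
    Function.update_of_ne (Finset.ne_of_mem_erase hj),
    Function.update_of_ne (Finset.ne_of_mem_erase hj)]

section Box

variable {a b : Fin n → ℝ}

/-- Lebesgue measure on each edge. -/
abbrev edgeMeasure (a b : Fin n → ℝ) (j : Fin n) : Measure ℝ :=
  (volume : Measure ℝ).restrict (Set.Ioo (a j) (b j))

theorem boxMeasure_eq_pi (a b : Fin n → ℝ) : boxMeasure a b = Measure.pi (edgeMeasure a b) := by
  rw [boxMeasure, box, volume_pi, Measure.restrict_pi_pi]

instance (i : Fin n) (c : ℝ) : IsFiniteMeasure (faceMeasure a b i c) := by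
  have := isFiniteMeasure_update (μ := edgeMeasure a b) i (Measure.dirac c)
  unfold faceMeasure
  infer_instance

instance : IsFiniteMeasure (boxMeasure a b) := by
  rw [boxMeasure_eq_pi]; infer_instance

instance : IsFiniteMeasure (surfaceMeasure a b) := by
  unfold surfaceMeasure; infer_instance

theorem ae_mem_Icc_pi {μ : Fin n → Measure ℝ} [∀ j, IsFiniteMeasure (μ j)]
    (h : ∀ j, ∀ᵐ t ∂μ j, t ∈ Set.Icc (a j) (b j)) : ∀ᵐ x ∂Measure.pi μ, x ∈ Set.Icc a b := by
  have : ∀ᵐ x ∂Measure.pi μ, ∀ j, x j ∈ Set.Icc (a j) (b j) :=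
    eventually_all.2 fun j => Measure.tendsto_eval_ae_ae.eventually (h j)
  filter_upwards [this] with x hx
  exact ⟨fun j => (hx j).1, fun j => (hx j).2⟩

theorem ae_mem_Icc_edge (j : Fin n) : ∀ᵐ t ∂edgeMeasure a b j, t ∈ Set.Icc (a j) (b j) := by
  filter_upwards [ae_restrict_mem measurableSet_Ioo] with t ht using ⟨ht.1.le, ht.2.le⟩

theorem ae_mem_Icc_box : ∀ᵐ x ∂boxMeasure a b, x ∈ Set.Icc a b := by
  rw [boxMeasure_eq_pi]; exact ae_mem_Icc_pi ae_mem_Icc_edge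

theorem ae_mem_Icc_face {i : Fin n} {c : ℝ} (hc : c ∈ Set.Icc (a i) (b i)) :
    ∀ᵐ x ∂faceMeasure a b i c, x ∈ Set.Icc a b := by
  have := isFiniteMeasure_update (μ := edgeMeasure a b) i (Measure.dirac c)
  refine ae_mem_Icc_pi (μ := Function.update (edgeMeasure a b) i (Measure.dirac c)) fun j => ?_
  rcases eq_or_ne j i with rfl | hj
  · rw [Function.update_self]
    exact (ae_dirac_iff measurableSet_Icc).2 hc
  · rw [Function.update_of_ne hj]; exact ae_mem_Icc_edge j

theorem ae_mem_Icc_surface (hab : ∀ i, a i < b i) :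
    ∀ᵐ x ∂surfaceMeasure a b, x ∈ Set.Icc a b := by
  rw [surfaceMeasure, ← Measure.sum_fintype, Measure.ae_sum_iff]
  intro i
  rw [ae_add_measure_iff]
  exact ⟨ae_mem_Icc_face ⟨le_rfl, (hab i).le⟩, ae_mem_Icc_face ⟨(hab i).le, le_rfl⟩⟩

theorem integrable_of_continuous {m : Measure (Fin n → ℝ)} [IsFiniteMeasure m]
    (h : ∀ᵐ x ∂m, x ∈ Set.Icc a b) {f : (Fin n → ℝ) → ℝ} (hf : Continuous f) :
    Integrable f m := by
  rw [← Measure.restrict_eq_self_of_ae_mem h]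
  exact hf.continuousOn.integrableOn_compact isCompact_Icc

theorem memLp_of_continuous {m : Measure (Fin n → ℝ)} [IsFiniteMeasure m]
    (h : ∀ᵐ x ∂m, x ∈ Set.Icc a b) {f : (Fin n → ℝ) → ℝ} (hf : Continuous f) :
    MemLp f 2 m :=
  (memLp_two_iff_integrable_sq hf.aestronglyMeasurable).2 (integrable_of_continuous h (hf.pow 2))

theorem integral_slice {ρ : Measure ℝ} [IsFiniteMeasure ρ] {i : Fin n} (c : ℝ)
    (hρ : ∀ᵐ t ∂ρ, t ∈ Set.Icc (a i) (b i)) {f : (Fin n → ℝ) → ℝ} (hf : Continuous f) :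
    ∫ x, f x ∂Measure.pi (Function.update (edgeMeasure a b) i ρ)
      = ∫ x, ∫ t, f (Function.update x i t) ∂ρ ∂faceMeasure a b i c := by
  have h1 := isFiniteMeasure_update (μ := edgeMeasure a b) i ρ
  have hae : ∀ᵐ x ∂Measure.pi (Function.update (edgeMeasure a b) i ρ), x ∈ Set.Icc a b := by
    refine ae_mem_Icc_pi fun j => ?_
    rcases eq_or_ne j i with rfl | hj
    · rw [Function.update_self]; exact hρ
    · rw [Function.update_of_ne hj]; exact ae_mem_Icc_edge j
  have hint := integrable_of_continuous hae hf
  have hm : Measurable (fun p : (Fin n → ℝ) × ℝ => Function.update p.1 i p.2) :=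
    (continuous_fst.update i continuous_snd).measurable
  have hmap := pi_update_eq_map (edgeMeasure a b) i ρ (Measure.dirac c)
  change _ = Measure.map _ ((faceMeasure a b i c).prod ρ) at hmap
  rw [hmap] at hint ⊢
  rw [integral_map hm.aemeasurable hf.aestronglyMeasurable]
  rw [integrable_map_measure hf.aestronglyMeasurable hm.aemeasurable] at hint
  exact integral_prod _ hint

theorem integral_box_slice (hab : ∀ i, a i < b i) (i : Fin n) {f : (Fin n → ℝ) → ℝ}
    (hf : Continuous f) :
    ∫ x, f x ∂boxMeasure a b
      = ∫ x, (∫ t in a i..b i, f (Function.update x i t)) ∂faceMeasure a b i (a i) := by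
  have := integral_slice (a i) (ae_mem_Icc_edge (a := a) (b := b) i) hf
  rw [Function.update_eq_self, ← boxMeasure_eq_pi] at this
  rw [this]
  congr 1
  funext x
  rw [intervalIntegral.integral_of_le (hab i).le, integral_Ioc_eq_integral_Ioo]

theorem integral_face_slice {i : Fin n} {c : ℝ} (hc : c ∈ Set.Icc (a i) (b i))
    {f : (Fin n → ℝ) → ℝ} (hf : Continuous f) :
    ∫ x, f x ∂faceMeasure a b i c
      = ∫ x, f (Function.update x i c) ∂faceMeasure a b i (a i) := by
  have := integral_slice (ρ := Measure.dirac c) (a i)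
    ((ae_dirac_iff measurableSet_Icc).2 hc) hf
  simp only [integral_dirac] at this
  exact this

theorem integral_surface (hab : ∀ i, a i < b i) {f : (Fin n → ℝ) → ℝ} (hf : Continuous f) :
    ∫ x, f x ∂surfaceMeasure a b
      = ∑ i, ((∫ x, f x ∂faceMeasure a b i (a i)) + ∫ x, f x ∂faceMeasure a b i (b i)) := by
  have ha : ∀ i, Integrable f (faceMeasure a b i (a i)) := fun i =>
    integrable_of_continuous (ae_mem_Icc_face ⟨le_rfl, (hab i).le⟩) hf
  have hb : ∀ i, Integrable f (faceMeasure a b i (b i)) := fun i =>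
    integrable_of_continuous (ae_mem_Icc_face ⟨(hab i).le, le_rfl⟩) hf
  rw [surfaceMeasure, integral_finsetSum_measure fun i _ => (ha i).add_measure (hb i)]
  exact Finset.sum_congr rfl fun i _ => integral_add_measure (ha i) (hb i)

theorem continuous_slice_integral (i : Fin n) {f : (Fin n → ℝ) → ℝ} {g : ℝ → ℝ}
    (hf : Continuous f) (hg : Continuous g) (c d : ℝ) :
    Continuous fun x => ∫ t in c..d, f (Function.update x i t) * g t := by
  refine intervalIntegral.continuous_parametric_intervalIntegral_of_continuous'
    (f := fun x t => f (Function.update x i t) * g t) ?_ c d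
  exact (hf.comp (continuous_fst.update i continuous_snd)).mul (hg.comp continuous_snd)

theorem hasDerivAt_slice {f : (Fin n → ℝ) → ℝ} (hf : ContDiff ℝ ∞ f) (i : Fin n)
    (x : Fin n → ℝ) (t : ℝ) :
    HasDerivAt (fun t => f (Function.update x i t))
      (partialDeriv i f (Function.update x i t)) t :=
  ((hf.differentiable (by simp) _).hasFDerivAt).comp_hasDerivAt t (hasDerivAt_update x i t)

theorem continuous_partialDeriv {f : (Fin n → ℝ) → ℝ} (hf : ContDiff ℝ ∞ f) (i : Fin n) :
    Continuous (partialDeriv i f) :=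
  (hf.continuous_fderiv (by simp)).clm_apply continuous_const

theorem continuous_update_right (x : Fin n → ℝ) (i : Fin n) :
    Continuous fun t : ℝ => Function.update x i t :=
  continuous_const.update i continuous_id

theorem partialDeriv_mul {f g : (Fin n → ℝ) → ℝ} (hf : ContDiff ℝ ∞ f) (hg : ContDiff ℝ ∞ g)
    (i : Fin n) (x : Fin n → ℝ) :
    partialDeriv i (fun x => f x * g x) x = f x * partialDeriv i g x + g x * partialDeriv i f x := by
  unfold partialDeriv
  rw [fderiv_fun_mul (hf.differentiable (by simp) x) (hg.differentiable (by simp) x)]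
  simp

/-- Integration of a partial derivative over the box. -/
theorem integral_partialDeriv (hab : ∀ i, a i < b i) {f : (Fin n → ℝ) → ℝ}
    (hf : ContDiff ℝ ∞ f) (i : Fin n) :
    ∫ x, partialDeriv i f x ∂boxMeasure a b
      = (∫ x, f x ∂faceMeasure a b i (b i)) - ∫ x, f x ∂faceMeasure a b i (a i) := by
  have cu : ∀ c : ℝ, Continuous fun x => f (Function.update x i c) := fun c =>
    hf.continuous.comp (continuous_id.update i continuous_const)
  have hR := ae_mem_Icc_face (a := a) (b := b) (i := i) ⟨le_rfl, (hab i).le⟩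
  rw [integral_box_slice hab i (continuous_partialDeriv hf i),
    integral_face_slice ⟨(hab i).le, le_rfl⟩ hf.continuous,
    integral_face_slice ⟨le_rfl, (hab i).le⟩ hf.continuous,
    ← integral_sub (integrable_of_continuous hR (cu _)) (integrable_of_continuous hR (cu _))]
  congr 1
  funext x
  exact intervalIntegral.integral_eq_sub_of_hasDerivAt (fun t _ => hasDerivAt_slice hf i x t)
    (((continuous_partialDeriv hf i).comp (continuous_update_right x i)).intervalIntegrable _ _)

end Box

end

section

variable {n : ℕ}

/-! ### Tensorisation of the spectral gap -/

/-- The coefficient of `f` along `φ i` in the `i`-th variable. -/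
def coef (a b : Fin n → ℝ) (φ : Fin n → ℝ → ℝ) (i : Fin n) (f : (Fin n → ℝ) → ℝ)
    (x : Fin n → ℝ) : ℝ :=
  ∫ t in a i..b i, f (Function.update x i t) * φ i t

/-- The projection onto `φ i` in the `i`-th variable. -/
def proj (a b : Fin n → ℝ) (φ : Fin n → ℝ → ℝ) (i : Fin n) (f : (Fin n → ℝ) → ℝ)
    (x : Fin n → ℝ) : ℝ :=
  φ i (x i) * coef a b φ i f x

/-- The product function `∏ i, φ i (x i)`. -/
def tensor (φ : Fin n → ℝ → ℝ) (x : Fin n → ℝ) : ℝ := ∏ i, φ i (x i)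

section

variable {a b : Fin n → ℝ} {φ : Fin n → ℝ → ℝ} {f g : (Fin n → ℝ) → ℝ}

theorem coef_update (i : Fin n) (x : Fin n → ℝ) (t : ℝ) :
    coef a b φ i f (Function.update x i t) = coef a b φ i f x := by
  simp [coef]

theorem proj_update (i : Fin n) (x : Fin n → ℝ) (t : ℝ) :
    proj a b φ i f (Function.update x i t) = φ i t * coef a b φ i f x := by
  simp [proj, coef_update]

theorem continuous_tensor (hφ : ∀ i, Continuous (φ i)) : Continuous (tensor φ) :=
  continuous_finsetProd _ fun i _ => (hφ i).comp (continuous_apply i)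

theorem continuous_coef (hφ : ∀ i, Continuous (φ i)) (hf : Continuous f) (i : Fin n) :
    Continuous (coef a b φ i f) :=
  continuous_slice_integral i hf (hφ i) _ _

theorem continuous_proj (hφ : ∀ i, Continuous (φ i)) (hf : Continuous f) (i : Fin n) :
    Continuous (proj a b φ i f) :=
  ((hφ i).comp (continuous_apply i)).mul (continuous_coef hφ hf i)

/-- The coefficient of `f` is constant along direction `i`, so Fubini leaves a symmetric expression
on the face; self-adjointness of the projection can be read off. -/
theorem integral_proj_mul (hab : ∀ i, a i < b i) (hφ : ∀ i, Continuous (φ i))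
    (hf : Continuous f) (hg : Continuous g) (i : Fin n) :
    ∫ x, proj a b φ i f x * g x ∂boxMeasure a b
      = ∫ x, coef a b φ i f x * coef a b φ i g x ∂faceMeasure a b i (a i) := by
  rw [integral_box_slice hab i (f := fun x => proj a b φ i f x * g x)
    ((continuous_proj hφ hf i).mul hg)]
  congr 1
  funext x
  simp only [proj_update]
  rw [show coef a b φ i g x = ∫ t in a i..b i, g (Function.update x i t) * φ i t from rfl,
    ← intervalIntegral.integral_const_mul]
  congr 1
  funext t
  ring

theorem integral_proj_mul_comm (hab : ∀ i, a i < b i) (hφ : ∀ i, Continuous (φ i))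
    (hf : Continuous f) (hg : Continuous g) (i : Fin n) :
    ∫ x, proj a b φ i f x * g x ∂boxMeasure a b
      = ∫ x, f x * proj a b φ i g x ∂boxMeasure a b := by
  simp only [mul_comm (f _)]
  rw [integral_proj_mul hab hφ hf hg, integral_proj_mul hab hφ hg hf]
  simp only [mul_comm]

theorem coef_proj (hnorm : ∀ i, ∫ t in a i..b i, φ i t ^ 2 = 1) (i : Fin n) :
    coef a b φ i (proj a b φ i f) = coef a b φ i f := by
  funext x
  rw [coef]
  simp only [proj_update]
  have : ∀ t, φ i t * coef a b φ i f x * φ i t = coef a b φ i f x * φ i t ^ 2 := fun t => by ring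
  simp only [this]
  rw [intervalIntegral.integral_const_mul, hnorm, mul_one]

theorem proj_idem (hnorm : ∀ i, ∫ t in a i..b i, φ i t ^ 2 = 1) (i : Fin n) :
    proj a b φ i (proj a b φ i f) = proj a b φ i f := by
  funext x
  rw [proj, coef_proj hnorm, proj]

theorem integral_proj_sq (hab : ∀ i, a i < b i) (hφ : ∀ i, Continuous (φ i))
    (hnorm : ∀ i, ∫ t in a i..b i, φ i t ^ 2 = 1) (hf : Continuous f) (i : Fin n) :
    ∫ x, proj a b φ i f x ^ 2 ∂boxMeasure a b
      = ∫ x, coef a b φ i f x ^ 2 ∂faceMeasure a b i (a i) := by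
  simp only [sq]
  rw [integral_proj_mul hab hφ hf (continuous_proj hφ hf i), coef_proj hnorm]

theorem integral_sub_proj_sq (hab : ∀ i, a i < b i) (hφ : ∀ i, Continuous (φ i))
    (hnorm : ∀ i, ∫ t in a i..b i, φ i t ^ 2 = 1) (hf : Continuous f) (i : Fin n) :
    ∫ x, (f x - proj a b φ i f x) ^ 2 ∂boxMeasure a b
      = (∫ x, f x ^ 2 ∂boxMeasure a b) - ∫ x, proj a b φ i f x ^ 2 ∂boxMeasure a b := by
  have cp := continuous_proj (a := a) (b := b) hφ hf i
  have hI : ∀ {g : (Fin n → ℝ) → ℝ}, Continuous g → Integrable g (boxMeasure a b) := fun hg =>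
    integrable_of_continuous ae_mem_Icc_box hg
  have e : ∀ x, (f x - proj a b φ i f x) ^ 2
      = f x ^ 2 - 2 * (proj a b φ i f x * f x) + proj a b φ i f x ^ 2 := fun x => by ring
  simp only [e]
  rw [integral_add (hI (by fun_prop)) (hI (by fun_prop)),
    integral_sub (hI (by fun_prop)) (hI (by fun_prop)), integral_const_mul,
    integral_proj_mul hab hφ hf hf, integral_proj_sq hab hφ hnorm hf]
  simp only [← sq]
  ring

theorem integral_proj_sq_le (hab : ∀ i, a i < b i) (hφ : ∀ i, Continuous (φ i))
    (hnorm : ∀ i, ∫ t in a i..b i, φ i t ^ 2 = 1) (hf : Continuous f) (i : Fin n) :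
    ∫ x, proj a b φ i f x ^ 2 ∂boxMeasure a b ≤ ∫ x, f x ^ 2 ∂boxMeasure a b := by
  rw [← sub_nonneg, ← integral_sub_proj_sq hab hφ hnorm hf]
  exact integral_nonneg fun x => sq_nonneg _

theorem proj_sub (hφ : ∀ i, Continuous (φ i)) (hf : Continuous f) (hg : Continuous g)
    (i : Fin n) (x : Fin n → ℝ) :
    proj a b φ i (fun x => f x - g x) x = proj a b φ i f x - proj a b φ i g x := by
  have hu := continuous_update_right x i
  have := hφ i
  have hI : ∀ {h : (Fin n → ℝ) → ℝ}, Continuous h → IntervalIntegrable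
      (fun t => h (Function.update x i t) * φ i t) volume (a i) (b i) := fun hh =>
    ((hh.comp hu).mul this).intervalIntegrable _ _
  simp only [proj, coef, sub_mul]
  rw [intervalIntegral.integral_sub (hI hf) (hI hg), mul_sub]

/-- For distinct variables this is Fubini for the two line integrals. -/
theorem proj_comm (hφ : ∀ i, Continuous (φ i)) (hf : Continuous f) (i j : Fin n) :
    proj a b φ i (proj a b φ j f) = proj a b φ j (proj a b φ i f) := by
  rcases eq_or_ne i j with rfl | hij
  · rfl
  funext x
  simp only [proj, coef, Function.update_of_ne hij, Function.update_of_ne hij.symm]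
  have e1 : ∀ t, φ j (x j) * (∫ s in a j..b j,
      f (Function.update (Function.update x i t) j s) * φ j s) * φ i t
      = φ j (x j) * ∫ s in a j..b j,
        f (Function.update (Function.update x i t) j s) * φ j s * φ i t := fun t => by
    rw [intervalIntegral.integral_mul_const]; ring
  have e2 : ∀ s, φ i (x i) * (∫ t in a i..b i,
      f (Function.update (Function.update x j s) i t) * φ i t) * φ j s
      = φ i (x i) * ∫ t in a i..b i,
        f (Function.update (Function.update x i t) j s) * φ j s * φ i t := fun s => by
    rw [mul_assoc, ← intervalIntegral.integral_mul_const]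
    congr 2
    funext t
    rw [Function.update_comm hij]
    ring
  simp only [e1, e2]
  rw [intervalIntegral.integral_const_mul, intervalIntegral.integral_const_mul,
    intervalIntegral_intervalIntegral_swap]
  · ring
  · have c1 := hφ i
    have c2 := hφ j
    have : Continuous (Function.uncurry fun t s : ℝ =>
        f (Function.update (Function.update x i t) j s) * φ j s * φ i t) := by
      refine ((hf.comp ((continuous_const.update i continuous_fst).update j
        continuous_snd)).mul (c2.comp continuous_snd)).mul (c1.comp continuous_fst)
    refine IntegrableOn.mono_set (t := Set.uIcc (a i) (b i) ×ˢ Set.uIcc (a j) (b j)) ?_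
      (Set.prod_mono Set.uIoc_subset_uIcc Set.uIoc_subset_uIcc)
    exact this.continuousOn.integrableOn_compact (isCompact_uIcc.prod isCompact_uIcc)

/-- Successive projections along a list of variables. -/
def projList (a b : Fin n → ℝ) (φ : Fin n → ℝ → ℝ) (l : List (Fin n))
    (f : (Fin n → ℝ) → ℝ) : (Fin n → ℝ) → ℝ :=
  l.foldl (fun g i => proj a b φ i g) f

theorem projList_nil : projList a b φ [] f = f := rfl

theorem projList_cons (i : Fin n) (l : List (Fin n)) :
    projList a b φ (i :: l) f = projList a b φ l (proj a b φ i f) := rfl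

theorem proj_projList_comm (hφ : ∀ i, Continuous (φ i)) (i : Fin n) (l : List (Fin n)) :
    ∀ {f : (Fin n → ℝ) → ℝ}, Continuous f →
      proj a b φ i (projList a b φ l f) = projList a b φ l (proj a b φ i f) := by
  induction l with
  | nil => intro f _; rw [projList_nil, projList_nil]
  | cons j t ih =>
    intro f hf
    rw [projList_cons, projList_cons, ih (continuous_proj hφ hf j), proj_comm hφ hf i j]

theorem proj_projList (hφ : ∀ i, Continuous (φ i))
    (hnorm : ∀ i, ∫ t in a i..b i, φ i t ^ 2 = 1) {i : Fin n} {l : List (Fin n)} :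
    ∀ {f : (Fin n → ℝ) → ℝ}, Continuous f → i ∈ l →
      proj a b φ i (projList a b φ l f) = projList a b φ l f := by
  induction l with
  | nil => exact fun _ h => absurd h (by simp)
  | cons j t ih =>
    intro f hf h
    rw [projList_cons]
    rcases List.mem_cons.1 h with rfl | h
    · rw [proj_projList_comm hφ _ _ (continuous_proj hφ hf _), proj_idem hnorm]
    · exact ih (continuous_proj hφ hf j) h

theorem integral_projList_mul (hab : ∀ i, a i < b i) (hφ : ∀ i, Continuous (φ i))
    (hg : Continuous g) (hgp : ∀ i, proj a b φ i g = g) (l : List (Fin n)) :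
    ∀ {f : (Fin n → ℝ) → ℝ}, Continuous f →
      ∫ x, projList a b φ l f x * g x ∂boxMeasure a b = ∫ x, f x * g x ∂boxMeasure a b := by
  induction l with
  | nil => exact fun _ => rfl
  | cons j t ih =>
    intro f hf
    rw [projList_cons, ih (continuous_proj hφ hf j), integral_proj_mul_comm hab hφ hf hg, hgp j]

/-- Tensorisation of the defect of a family of commuting projections. -/
theorem integral_sub_projList_le (hab : ∀ i, a i < b i) (hφ : ∀ i, Continuous (φ i))
    (hnorm : ∀ i, ∫ t in a i..b i, φ i t ^ 2 = 1) (l : List (Fin n)) :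
    ∀ {f : (Fin n → ℝ) → ℝ}, Continuous f →
      (∫ x, f x ^ 2 ∂boxMeasure a b) - ∫ x, projList a b φ l f x ^ 2 ∂boxMeasure a b
        ≤ (l.map fun i => (∫ x, f x ^ 2 ∂boxMeasure a b)
            - ∫ x, proj a b φ i f x ^ 2 ∂boxMeasure a b).sum := by
  induction l with
  | nil => intro f _; simp [projList]
  | cons i t ih =>
    intro f hf
    have cp := continuous_proj (a := a) (b := b) hφ hf i
    have h1 := ih cp
    -- Projecting first can only shrink the remaining defects: by commutation `(1 - P_j) P_i f = P_i
    -- (1 - P_j) f`, and `P_i` is a contraction.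
    have h2 : (t.map fun j => (∫ x, proj a b φ i f x ^ 2 ∂boxMeasure a b)
          - ∫ x, proj a b φ j (proj a b φ i f) x ^ 2 ∂boxMeasure a b).sum
        ≤ (t.map fun j => (∫ x, f x ^ 2 ∂boxMeasure a b)
            - ∫ x, proj a b φ j f x ^ 2 ∂boxMeasure a b).sum := by
      refine List.sum_le_sum fun j _ => ?_
      have cj := continuous_proj (a := a) (b := b) hφ hf j
      rw [← integral_sub_proj_sq hab hφ hnorm cp, ← integral_sub_proj_sq hab hφ hnorm hf,
        proj_comm hφ hf j i]
      simp only [← proj_sub hφ hf cj]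
      exact integral_proj_sq_le hab hφ hnorm (hf.sub cj) i
    rw [List.map_cons, List.sum_cons, projList_cons]
    linarith

theorem tensor_update (i : Fin n) (x : Fin n → ℝ) (t : ℝ) :
    tensor φ (Function.update x i t) = φ i t * ∏ j ∈ Finset.univ.erase i, φ j (x j) := by
  rw [tensor, ← Finset.mul_prod_erase Finset.univ _ (Finset.mem_univ i), Function.update_self]
  congr 1
  exact Finset.prod_congr rfl fun j hj => by
    rw [Function.update_of_ne (Finset.ne_of_mem_erase hj)]

theorem proj_tensor (hnorm : ∀ i, ∫ t in a i..b i, φ i t ^ 2 = 1) (i : Fin n) :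
    proj a b φ i (tensor φ) = tensor φ := by
  funext x
  rw [proj, coef]
  simp only [tensor_update]
  have : ∀ t, φ i t * (∏ j ∈ Finset.univ.erase i, φ j (x j)) * φ i t
    = (∏ j ∈ Finset.univ.erase i, φ j (x j)) * φ i t ^ 2 := fun t => by ring
  simp only [this]
  rw [intervalIntegral.integral_const_mul, hnorm, mul_one,
    Finset.mul_prod_erase Finset.univ (fun j => φ j (x j)) (Finset.mem_univ i), tensor]

theorem integral_tensor_sq (hab : ∀ i, a i < b i) :
    ∫ x, tensor φ x ^ 2 ∂boxMeasure a b = ∏ i, ∫ t in a i..b i, φ i t ^ 2 := by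
  rw [boxMeasure_eq_pi]
  simp only [tensor, ← Finset.prod_pow]
  rw [integral_fintype_prod_eq_prod (fun i t => φ i t ^ 2)]
  refine Finset.prod_congr rfl fun i _ => ?_
  rw [intervalIntegral.integral_of_le (hab i).le, integral_Ioc_eq_integral_Ioo]

/-- A function fixed by all projections is proportional to the product function. -/
theorem mul_tensor_comm (hfix : ∀ i, proj a b φ i f = f) (x y : Fin n → ℝ) :
    f y * tensor φ x = f x * tensor φ y := by
  -- A function fixed by the `i`-th projection is `φ i (x i)` times a factor free of `x i`. The
  -- relation is kept cross-multiplied, so zeros of `φ i` do no harm; coordinates are then exchanged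
  -- one at a time.
  have hstep : ∀ (i : Fin n) (x : Fin n → ℝ) (t : ℝ),
      f (Function.update x i t) * φ i (x i) = f x * φ i t := by
    intro i x t
    rw [← hfix i, proj_update, proj]
    ring
  have key : ∀ s : Finset (Fin n), f (s.piecewise y x) * ∏ i ∈ s, φ i (x i)
      = f x * ∏ i ∈ s, φ i (y i) := by
    intro s
    induction s using Finset.induction_on with
    | empty => simp
    | insert i s hi ih =>
      rw [Finset.piecewise_insert, Finset.prod_insert hi, Finset.prod_insert hi, ← mul_assoc]
      have := hstep i (s.piecewise y x) (y i)
      rw [Finset.piecewise_eq_of_notMem _ _ _ hi] at this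
      rw [this, mul_right_comm, ih]
      ring
  simpa [tensor] using key Finset.univ

/-- The tensorised spectral gap inequality. -/
theorem integral_sq_sub_le_sum (hab : ∀ i, a i < b i) (hφ : ∀ i, Continuous (φ i))
    (hnorm : ∀ i, ∫ t in a i..b i, φ i t ^ 2 = 1) (hf : Continuous f) :
    (∫ x, f x ^ 2 ∂boxMeasure a b) - (∫ x, f x * tensor φ x ∂boxMeasure a b) ^ 2
      ≤ ∑ i, ((∫ x, f x ^ 2 ∂boxMeasure a b)
          - ∫ x, coef a b φ i f x ^ 2 ∂faceMeasure a b i (a i)) := by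
  have hT : ∫ x, tensor φ x ^ 2 ∂boxMeasure a b = 1 := by
    rw [integral_tensor_sq hab, Finset.prod_eq_one fun i _ => hnorm i]
  have h1 := integral_sub_projList_le hab hφ hnorm (List.finRange n) hf
  set h := projList a b φ (List.finRange n) f with hdef
  have hfix : ∀ i, proj a b φ i h = h := fun i =>
    proj_projList hφ hnorm hf (List.mem_finRange i)
  have hc := integral_projList_mul hab hφ (continuous_tensor hφ) (proj_tensor hnorm)
    (List.finRange n) hf
  rw [← hdef] at hc
  -- Proportionality to `tensor φ`, multiplied by `tensor φ x` and integrated in `x`, identifies the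
  -- constant, since `tensor φ` has unit norm and the projections preserve the pairing with it.
  have hprop : ∀ y, h y = (∫ x, f x * tensor φ x ∂boxMeasure a b) * tensor φ y := by
    intro y
    rw [← hc, ← mul_one (h y), ← hT, ← integral_const_mul, ← integral_mul_const]
    congr 1
    funext x
    have := mul_tensor_comm hfix x y
    rw [sq, ← mul_assoc, this]
    ring
  have h2 : ∫ x, h x ^ 2 ∂boxMeasure a b = (∫ x, f x * tensor φ x ∂boxMeasure a b) ^ 2 := by
    generalize (∫ x, f x * tensor φ x ∂boxMeasure a b) = c at hprop ⊢
    simp only [hprop, mul_pow]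
    rw [integral_const_mul, hT, mul_one]
  rw [h2, ← Fin.sum_univ_def] at h1
  simpa only [integral_proj_sq hab hφ hnorm hf] using h1

end

end

section

variable {n : ℕ} {a b : Fin n → ℝ}

/-! ### The Robin form on smooth functions -/

theorem contDiff_partialDeriv {f : (Fin n → ℝ) → ℝ} (hf : ContDiff ℝ ∞ f) (i : Fin n) :
    ContDiff ℝ ∞ (partialDeriv i f) :=
  (hf.fderiv_right (m := ∞) (by simp)).clm_apply contDiff_const

theorem contDiff_tensor {y : Fin n → ℝ → ℝ} (hy : ∀ i, ContDiff ℝ ∞ (y i)) :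
    ContDiff ℝ ∞ (tensor y) :=
  contDiff_prod fun i _ => (hy i).comp (contDiff_apply ℝ ℝ i)

theorem partialDeriv_eq_of_slice {f : (Fin n → ℝ) → ℝ} (hf : ContDiff ℝ ∞ f) {i : Fin n}
    {x : Fin n → ℝ} {t d : ℝ} (h : HasDerivAt (fun t => f (Function.update x i t)) d t) :
    partialDeriv i f (Function.update x i t) = d :=
  (hasDerivAt_slice hf i x t).unique h

section Tensor

variable {α : ℝ} {m : Fin n → ℝ} {y : Fin n → ℝ → ℝ}

theorem partialDeriv_tensor_update (hy : ∀ i, RobinMode (a i) (b i) α (m i) (y i)) (i : Fin n)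
    (x : Fin n → ℝ) (t : ℝ) :
    partialDeriv i (tensor y) (Function.update x i t)
      = deriv (y i) t * ∏ j ∈ Finset.univ.erase i, y j (x j) := by
  refine partialDeriv_eq_of_slice (contDiff_tensor fun i => (hy i).smooth) ?_
  simp only [tensor_update]
  exact ((hy i).hasDerivAt t).mul_const _

theorem partialDeriv_partialDeriv_tensor (hy : ∀ i, RobinMode (a i) (b i) α (m i) (y i))
    (i : Fin n) (x : Fin n → ℝ) :
    partialDeriv i (partialDeriv i (tensor y)) x = -m i * tensor y x := by
  have h : partialDeriv i (partialDeriv i (tensor y)) (Function.update x i (x i))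
      = -m i * y i (x i) * ∏ j ∈ Finset.univ.erase i, y j (x j) := by
    refine partialDeriv_eq_of_slice
      (contDiff_partialDeriv (contDiff_tensor fun i => (hy i).smooth) i) ?_
    simp only [partialDeriv_tensor_update hy]
    exact ((hy i).ode (x i)).mul_const _
  rw [Function.update_eq_self] at h
  rw [h, mul_assoc, Finset.mul_prod_erase Finset.univ (fun j => y j (x j)) (Finset.mem_univ i),
    tensor]

/-- The divergence theorem in direction `i` applied to `∂ᵢT * v`, where `T` is the product: the two
endpoint Robin conditions turn the face terms into the `α` terms, and the ODE supplies `m i`.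
Summing over `i` gives the weak equation. -/
theorem integral_weak_slice (hab : ∀ i, a i < b i)
    (hy : ∀ i, RobinMode (a i) (b i) α (m i) (y i)) {v : (Fin n → ℝ) → ℝ}
    (hv : ContDiff ℝ ∞ v) (i : Fin n) :
    (∫ x, partialDeriv i (tensor y) x * partialDeriv i v x ∂boxMeasure a b)
      + α * ((∫ x, tensor y x * v x ∂faceMeasure a b i (a i))
        + ∫ x, tensor y x * v x ∂faceMeasure a b i (b i))
      = m i * ∫ x, tensor y x * v x ∂boxMeasure a b := by
  have hT := contDiff_tensor fun i => (hy i).smooth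
  have hD := contDiff_partialDeriv hT i
  have hdiv := integral_partialDeriv hab (hD.mul hv) i
  simp only [partialDeriv_mul hD hv, partialDeriv_partialDeriv_tensor hy] at hdiv
  have cT := hT.continuous
  have cv := hv.continuous
  have cD := hD.continuous
  have cv' := continuous_partialDeriv hv i
  have hI : ∀ {g : (Fin n → ℝ) → ℝ}, Continuous g → Integrable g (boxMeasure a b) := fun hg =>
    integrable_of_continuous ae_mem_Icc_box hg
  have e : ∀ x, v x * (-m i * tensor y x) = -m i * (tensor y x * v x) := fun x => by ring
  simp only [e] at hdiv
  rw [integral_add (hI (by fun_prop)) (hI (by fun_prop)), integral_const_mul] at hdiv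
  have hb : ∫ x, partialDeriv i (tensor y) x * v x ∂faceMeasure a b i (b i)
      = -α * ∫ x, tensor y x * v x ∂faceMeasure a b i (b i) := by
    have hc : b i ∈ Set.Icc (a i) (b i) := ⟨(hab i).le, le_rfl⟩
    rw [integral_face_slice hc (f := fun x => partialDeriv i (tensor y) x * v x) (cD.mul cv),
      integral_face_slice hc (f := fun x => tensor y x * v x) (cT.mul cv), ← integral_const_mul]
    congr 1
    funext x
    rw [partialDeriv_tensor_update hy, (hy i).robin_right, tensor_update]
    ring
  have ha : ∫ x, partialDeriv i (tensor y) x * v x ∂faceMeasure a b i (a i)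
      = α * ∫ x, tensor y x * v x ∂faceMeasure a b i (a i) := by
    have hc : a i ∈ Set.Icc (a i) (b i) := ⟨le_rfl, (hab i).le⟩
    rw [integral_face_slice hc (f := fun x => partialDeriv i (tensor y) x * v x) (cD.mul cv),
      integral_face_slice hc (f := fun x => tensor y x * v x) (cT.mul cv), ← integral_const_mul]
    congr 1
    funext x
    rw [partialDeriv_tensor_update hy, (hy i).robin_left, tensor_update]
    ring
  rw [ha, hb] at hdiv
  linarith

/-- Products of interval modes solve the weak Robin problem against smooth functions. -/
theorem integral_weak_tensor (hab : ∀ i, a i < b i)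
    (hy : ∀ i, RobinMode (a i) (b i) α (m i) (y i)) {v : (Fin n → ℝ) → ℝ}
    (hv : ContDiff ℝ ∞ v) :
    (∑ i, ∫ x, partialDeriv i (tensor y) x * partialDeriv i v x ∂boxMeasure a b)
      + α * ∫ x, tensor y x * v x ∂surfaceMeasure a b
      = (∑ i, m i) * ∫ x, tensor y x * v x ∂boxMeasure a b := by
  rw [integral_surface hab (f := fun x => tensor y x * v x)
    ((contDiff_tensor fun i => (hy i).smooth).continuous.mul hv.continuous), Finset.mul_sum,
    Finset.sum_mul, ← Finset.sum_add_distrib]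
  exact Finset.sum_congr rfl fun i _ => integral_weak_slice hab hy hv i

end Tensor

section Gap

variable (S : ∀ i, IntervalSpectrum (a i) (b i)) (α : ℝ)

/-- The interval inequality on each line parallel to axis `i`, integrated over the face. -/
theorem gap_slice (hab : ∀ i, a i < b i) {v : (Fin n → ℝ) → ℝ} (hv : ContDiff ℝ ∞ v)
    (i : Fin n) :
    ((S i).ν α - (S i).μ α) * ((∫ x, v x ^ 2 ∂boxMeasure a b)
        - ∫ x, coef a b (fun i => (S i).φ α) i v x ^ 2 ∂faceMeasure a b i (a i))
      ≤ (∫ x, partialDeriv i v x ^ 2 ∂boxMeasure a b)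
        + α * ((∫ x, v x ^ 2 ∂faceMeasure a b i (a i)) + ∫ x, v x ^ 2 ∂faceMeasure a b i (b i))
        - (S i).μ α * ∫ x, v x ^ 2 ∂boxMeasure a b := by
  have cv := hv.continuous
  have cv' := continuous_partialDeriv hv i
  have hφ : ∀ i, Continuous ((S i).φ α) := fun i => ((S i).mode_φ α).continuous
  have hac : a i ∈ Set.Icc (a i) (b i) := ⟨le_rfl, (hab i).le⟩
  have hbc : b i ∈ Set.Icc (a i) (b i) := ⟨(hab i).le, le_rfl⟩
  have cu : ∀ c : ℝ, Continuous fun x : Fin n → ℝ => Function.update x i c := fun c =>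
    continuous_id.update i continuous_const
  have cva := cv.comp (cu (a i))
  have cvb := cv.comp (cu (b i))
  simp only [Function.comp_def] at cva cvb
  have hI : ∀ {g : (Fin n → ℝ) → ℝ}, Continuous g → Integrable g (faceMeasure a b i (a i)) :=
    fun hg => integrable_of_continuous (ae_mem_Icc_face hac) hg
  have cs : ∀ {g : (Fin n → ℝ) → ℝ}, Continuous g →
      Continuous fun x => ∫ t in a i..b i, g (Function.update x i t) := fun hg => by
    simpa using continuous_slice_integral i hg (continuous_const (y := (1 : ℝ))) (a i) (b i)
  have c1 := cs (cv.pow 2)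
  have c2 := cs (cv'.pow 2)
  have c3 := continuous_coef (a := a) (b := b) hφ cv i
  have cva2 : Continuous fun x => v (Function.update x i (a i)) ^ 2 := cva.pow 2
  have cvb2 : Continuous fun x => v (Function.update x i (b i)) ^ 2 := cvb.pow 2
  have c4 : Continuous fun x => coef a b (fun i => (S i).φ α) i v x ^ 2 := c3.pow 2
  simp only [Pi.pow_apply] at c1 c2
  have c5 := (cva2.fun_add cvb2).const_mul α
  have c6 := c2.fun_add c5
  have c7 := c1.const_mul ((S i).μ α)
  rw [integral_box_slice hab i (f := fun x => v x ^ 2) (cv.pow 2),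
    integral_box_slice hab i (f := fun x => partialDeriv i v x ^ 2) (cv'.pow 2),
    integral_face_slice hac (f := fun x => v x ^ 2) (cv.pow 2),
    integral_face_slice hbc (f := fun x => v x ^ 2) (cv.pow 2),
    ← integral_sub (hI c1) (hI c4), ← integral_const_mul,
    ← integral_add (hI cva2) (hI cvb2), ← integral_const_mul, ← integral_const_mul,
    ← integral_add (hI c2) (hI c5), ← integral_sub (hI c6) (hI c7)]
  refine integral_mono (hI ((c1.fun_sub c4).const_mul _)) (hI (c6.fun_sub c7)) fun x => ?_
  exact (S i).gap α (fun t => v (Function.update x i t)) _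
    (fun t => hasDerivAt_slice hv i x t) (cv'.comp (continuous_update_right x i))

/-- Spectral gap inequality on the box for smooth functions. -/
theorem gap_box (hab : ∀ i, a i < b i) {v : (Fin n → ℝ) → ℝ} (hv : ContDiff ℝ ∞ v) {γ : ℝ}
    (hγ : 0 ≤ γ) (hγS : ∀ i, γ ≤ (S i).ν α - (S i).μ α) :
    γ * ((∫ x, v x ^ 2 ∂boxMeasure a b)
        - (∫ x, v x * tensor (fun i => (S i).φ α) x ∂boxMeasure a b) ^ 2)
      ≤ (∑ i, ∫ x, partialDeriv i v x ^ 2 ∂boxMeasure a b)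
        + α * (∫ x, v x ^ 2 ∂surfaceMeasure a b)
        - (∑ i, (S i).μ α) * ∫ x, v x ^ 2 ∂boxMeasure a b := by
  have hφ : ∀ i, Continuous ((S i).φ α) := fun i => ((S i).mode_φ α).continuous
  have hnorm := fun i => (S i).φ_norm α
  refine (mul_le_mul_of_nonneg_left
    (integral_sq_sub_le_sum hab hφ hnorm hv.continuous) hγ).trans ?_
  rw [integral_surface hab (f := fun x => v x ^ 2) (hv.continuous.pow 2), Finset.mul_sum,
    Finset.mul_sum, Finset.sum_mul, ← Finset.sum_add_distrib, ← Finset.sum_sub_distrib]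
  refine Finset.sum_le_sum fun i _ => le_trans (mul_le_mul_of_nonneg_right (hγS i) ?_)
    (gap_slice S α hab hv i)
  -- Lowering each edge gap to the common `γ` is legitimate because every projection defect is
  -- nonnegative.
  rw [← integral_proj_sq hab hφ hnorm hv.continuous, sub_nonneg]
  exact integral_proj_sq_le hab hφ hnorm hv.continuous i

end Gap

end

section

variable {n : ℕ} {a b : Fin n → ℝ}

/-! ### The weak Robin problem in `L²` -/

theorem integral_mul_eq_inner {m : Measure (Fin n → ℝ)} (u v : Lp ℝ 2 m) :
    ∫ x, u x * v x ∂m = inner ℝ u v := by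
  rw [L2.inner_def]
  simp [mul_comm]

theorem integrable_mul_Lp {m : Measure (Fin n → ℝ)} (u v : Lp ℝ 2 m) :
    Integrable (fun x => u x * v x) m :=
  (Lp.memLp u).integrable_mul (Lp.memLp v)

theorem inner_toLp {m : Measure (Fin n → ℝ)} {f g : (Fin n → ℝ) → ℝ} (hf : MemLp f 2 m)
    (hg : MemLp g 2 m) : inner ℝ (hf.toLp f) (hg.toLp g) = ∫ x, f x * g x ∂m := by
  rw [← integral_mul_eq_inner]
  refine integral_congr_ae ?_
  filter_upwards [hf.coeFn_toLp, hg.coeFn_toLp] with x h1 h2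
  rw [h1, h2]

theorem tendsto_toLp {m : Measure (Fin n → ℝ)} {f : ℕ → (Fin n → ℝ) → ℝ}
    (hf : ∀ k, MemLp (f k) 2 m) {u : Lp ℝ 2 m}
    (h : Tendsto (fun k => eLpNorm (fun x => f k x - u x) 2 m) atTop (𝓝 0)) :
    Tendsto (fun k => (hf k).toLp (f k)) atTop (𝓝 u) := by
  have := (Lp.tendsto_Lp_iff_tendsto_eLpNorm'' f hf u (Lp.memLp u)).2 h
  rwa [Lp.toLp_coeFn] at this

/-- A continuous function as an element of `L²(B)`. -/
def toBox (a b : Fin n → ℝ) {f : (Fin n → ℝ) → ℝ} (hf : Continuous f) : L2 a b :=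
  (memLp_of_continuous ae_mem_Icc_box hf).toLp f

/-- A continuous function as an element of `L²(∂B)`. -/
def toBoundary (hab : ∀ i, a i < b i) {f : (Fin n → ℝ) → ℝ} (hf : Continuous f) :
    L2Boundary a b :=
  (memLp_of_continuous (ae_mem_Icc_surface hab) hf).toLp f

/-- The Robin bilinear form in terms of gradients and traces. -/
def robinForm (α : ℝ) (G : Fin n → L2 a b) (g : L2Boundary a b) (H : Fin n → L2 a b)
    (h : L2Boundary a b) : ℝ :=
  (∑ i, inner ℝ (G i) (H i)) + α * inner ℝ g h

theorem robinForm_comm (α : ℝ) (G H : Fin n → L2 a b) (g h : L2Boundary a b) :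
    robinForm α G g H h = robinForm α H h G g := by
  simp only [robinForm, real_inner_comm]

theorem integral_form_eq (α : ℝ) (G H : Fin n → L2 a b) (g h : L2Boundary a b) :
    ∫ x, ∑ i, G i x * H i x ∂boxMeasure a b + α * ∫ x, g x * h x ∂surfaceMeasure a b
      = robinForm α G g H h := by
  rw [integral_finsetSum _ fun i _ => integrable_mul_Lp (G i) (H i), robinForm,
    integral_mul_eq_inner]
  simp only [integral_mul_eq_inner]

theorem isRobinEigenfunction_iff {α ν : ℝ} {u : L2 a b} :
    IsRobinEigenfunction a b α ν u ↔ u ≠ 0 ∧ ∃ (G : Fin n → L2 a b) (g : L2Boundary a b),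
      HasWeakGradient u G ∧ HasTrace u G g ∧
      ∀ (v : L2 a b) (H : Fin n → L2 a b) (h : L2Boundary a b),
        HasWeakGradient v H → HasTrace v H h → robinForm α G g H h = ν * inner ℝ u v := by
  simp only [IsRobinEigenfunction, integral_form_eq]
  simp only [integral_mul_eq_inner]

/-- The smooth approximations in the definition of the trace, as convergence in `L²`. -/
theorem HasTrace.exists_seq (hab : ∀ i, a i < b i) {u : L2 a b} {G : Fin n → L2 a b}
    {g : L2Boundary a b} (h : HasTrace u G g) :
    ∃ (f : ℕ → (Fin n → ℝ) → ℝ) (hf : ∀ k, ContDiff ℝ ∞ (f k)),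
      Tendsto (fun k => toBox a b (hf k).continuous) atTop (𝓝 u) ∧
      (∀ i, Tendsto (fun k => toBox a b (continuous_partialDeriv (hf k) i)) atTop (𝓝 (G i))) ∧
      Tendsto (fun k => toBoundary hab (hf k).continuous) atTop (𝓝 g) := by
  obtain ⟨f, hf, h1, h2, h3⟩ := h
  exact ⟨f, hf, tendsto_toLp _ h1, fun i => tendsto_toLp _ (h2 i), tendsto_toLp _ h3⟩

/-- Integration by parts against a test function; the face terms vanish because the support of the
test function lies in the open box. -/
theorem hasWeakGradient_toBox (hab : ∀ i, a i < b i) {f : (Fin n → ℝ) → ℝ}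
    (hf : ContDiff ℝ ∞ f) :
    HasWeakGradient (toBox a b hf.continuous)
      (fun i => toBox a b (continuous_partialDeriv hf i)) := by
  intro i ψ hψ _ hsupp
  have e1 : ∫ x, toBox a b hf.continuous x * partialDeriv i ψ x ∂boxMeasure a b
      = ∫ x, f x * partialDeriv i ψ x ∂boxMeasure a b := by
    refine integral_congr_ae ?_
    filter_upwards [(memLp_of_continuous ae_mem_Icc_box hf.continuous).coeFn_toLp] with x hx
    rw [toBox, hx]
  have e2 : ∫ x, toBox a b (continuous_partialDeriv hf i) x * ψ x ∂boxMeasure a b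
      = ∫ x, ψ x * partialDeriv i f x ∂boxMeasure a b := by
    refine integral_congr_ae ?_
    filter_upwards [(memLp_of_continuous ae_mem_Icc_box
      (continuous_partialDeriv hf i)).coeFn_toLp] with x hx
    rw [toBox, hx, mul_comm]
  have hdiv := integral_partialDeriv hab (hf.mul hψ) i
  simp only [partialDeriv_mul hf hψ] at hdiv
  have cf := hf.continuous
  have cψ := hψ.continuous
  have cf' := continuous_partialDeriv hf i
  have cψ' := continuous_partialDeriv hψ i
  rw [integral_add (integrable_of_continuous ae_mem_Icc_box (by fun_prop))
    (integrable_of_continuous ae_mem_Icc_box (by fun_prop))] at hdiv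
  have hface : ∀ c ∈ Set.Icc (a i) (b i), c ∉ Set.Ioo (a i) (b i) →
      ∫ x, f x * ψ x ∂faceMeasure a b i c = 0 := by
    intro c hc hc'
    rw [integral_face_slice hc (f := fun x => f x * ψ x) (cf.mul cψ)]
    refine integral_eq_zero_of_ae (Eventually.of_forall fun x => ?_)
    have : ψ (Function.update x i c) = 0 := by
      refine image_eq_zero_of_notMem_tsupport fun hmem => hc' ?_
      simpa using hsupp hmem i (Set.mem_univ i)
    simp [this]
  rw [hface _ ⟨(hab i).le, le_rfl⟩ (fun h => lt_irrefl _ h.2),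
    hface _ ⟨le_rfl, (hab i).le⟩ (fun h => lt_irrefl _ h.1)] at hdiv
  rw [e1, e2]
  linarith

theorem hasTrace_toBox (hab : ∀ i, a i < b i) {f : (Fin n → ℝ) → ℝ} (hf : ContDiff ℝ ∞ f) :
    HasTrace (toBox a b hf.continuous) (fun i => toBox a b (continuous_partialDeriv hf i))
      (toBoundary hab hf.continuous) := by
  have key : ∀ {m : Measure (Fin n → ℝ)} {g : (Fin n → ℝ) → ℝ} (hg : MemLp g 2 m),
      Tendsto (fun _ : ℕ => eLpNorm (fun x => g x - hg.toLp g x) 2 m) atTop (𝓝 0) := by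
    intro m g hg
    have : eLpNorm (fun x => g x - hg.toLp g x) 2 m = 0 := by
      rw [eLpNorm_congr_ae (g := fun _ => (0 : ℝ))]
      · simp
      · filter_upwards [hg.coeFn_toLp] with x hx
        rw [hx, sub_self]
    rw [this]
    exact tendsto_const_nhds
  exact ⟨fun _ => f, fun _ => hf, key _, fun i => key _, key _⟩

/-- Products of interval modes are Robin eigenfunctions of the box. -/
theorem isRobinEigenfunction_tensor (hab : ∀ i, a i < b i) {α : ℝ} {m : Fin n → ℝ}
    {y : Fin n → ℝ → ℝ} (hy : ∀ i, RobinMode (a i) (b i) α (m i) (y i))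
    (hpos : ∀ i, 0 < ∫ t in a i..b i, y i t ^ 2) :
    IsRobinEigenfunction a b α (∑ i, m i)
      (toBox a b (contDiff_tensor fun i => (hy i).smooth).continuous) := by
  have hT := contDiff_tensor fun i => (hy i).smooth
  rw [isRobinEigenfunction_iff]
  refine ⟨fun h0 => ?_, _, _, hasWeakGradient_toBox hab hT, hasTrace_toBox hab hT,
    fun v H h _ hv => ?_⟩
  · have h1 : inner ℝ (toBox a b hT.continuous) (toBox a b hT.continuous)
        = ∏ i, ∫ t in a i..b i, y i t ^ 2 := by
      rw [← integral_tensor_sq hab, toBox, inner_toLp]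
      simp only [sq]
    rw [h0, inner_zero_left] at h1
    exact (Finset.prod_pos fun i _ => hpos i).ne h1
  -- The weak identity is known for smooth test functions. Both sides are continuous in the `L²`
  -- norms of function, gradient and trace, so it survives the limit along the approximations in
  -- `HasTrace`.
  · obtain ⟨f, hf, l1, l2, l3⟩ := hv.exists_seq hab
    have hL : Tendsto (fun k => robinForm α (fun i => toBox a b (continuous_partialDeriv hT i))
        (toBoundary hab hT.continuous) (fun i => toBox a b (continuous_partialDeriv (hf k) i))
        (toBoundary hab (hf k).continuous)) atTop (𝓝 (robinForm α
          (fun i => toBox a b (continuous_partialDeriv hT i))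
          (toBoundary hab hT.continuous) H h)) :=
      (tendsto_finsetSum _ fun i _ => tendsto_const_nhds.inner (l2 i)).add
        ((tendsto_const_nhds.inner l3).const_mul α)
    have hR := (Tendsto.inner (𝕜 := ℝ)
      (tendsto_const_nhds (x := toBox a b hT.continuous)) l1).const_mul (∑ i, m i)
    refine tendsto_nhds_unique hL (hR.congr fun k => ?_)
    simp only [robinForm, toBox, toBoundary, inner_toLp]
    exact (integral_weak_tensor hab hy (hf k)).symm

/-- Spectral gap inequality on the box for `H¹` functions. -/
theorem gap_form (S : ∀ i, IntervalSpectrum (a i) (b i)) (α : ℝ) (hab : ∀ i, a i < b i) {γ : ℝ}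
    (hγ : 0 ≤ γ) (hγS : ∀ i, γ ≤ (S i).ν α - (S i).μ α) {u : L2 a b} {G : Fin n → L2 a b}
    {g : L2Boundary a b} (hu : HasTrace u G g) :
    γ * (inner ℝ u u - inner ℝ u (toBox a b
        (contDiff_tensor fun i => ((S i).mode_φ α).smooth).continuous) ^ 2)
      ≤ robinForm α G g G g - (∑ i, (S i).μ α) * inner ℝ u u := by
  have hT := contDiff_tensor fun i => ((S i).mode_φ α).smooth
  obtain ⟨f, hf, l1, l2, l3⟩ := hu.exists_seq hab
  have i1 := Tendsto.inner (𝕜 := ℝ) l1 l1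
  have i2 := (Tendsto.inner (𝕜 := ℝ) l1
    (tendsto_const_nhds (x := toBox a b hT.continuous))).pow 2
  have i3 : Tendsto (fun k => robinForm α
      (fun i => toBox a b (continuous_partialDeriv (hf k) i)) (toBoundary hab (hf k).continuous)
      (fun i => toBox a b (continuous_partialDeriv (hf k) i)) (toBoundary hab (hf k).continuous))
      atTop (𝓝 (robinForm α G g G g)) :=
    (tendsto_finsetSum _ fun i _ => (l2 i).inner (l2 i)).add ((l3.inner l3).const_mul α)
  refine le_of_tendsto_of_tendsto' ((i1.sub i2).const_mul γ)
    (i3.sub (i1.const_mul (∑ i, (S i).μ α))) fun k => ?_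
  simp only [robinForm, toBox, toBoundary, inner_toLp, ← sq]
  exact gap_box S α hab (hf k) hγ hγS

/-- Eigenfunctions for distinct eigenvalues are orthogonal. -/
theorem IsRobinEigenfunction.inner_eq_zero {α ν₁ ν₂ : ℝ} {u v : L2 a b}
    (hu : IsRobinEigenfunction a b α ν₁ u) (hv : IsRobinEigenfunction a b α ν₂ v)
    (hne : ν₁ ≠ ν₂) : inner ℝ u v = 0 := by
  obtain ⟨-, G, g, hG, hg, h1⟩ := isRobinEigenfunction_iff.1 hu
  obtain ⟨-, H, h, hH, hh, h2⟩ := isRobinEigenfunction_iff.1 hv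
  have e1 := h1 v H h hH hh
  have e2 := h2 u G g hG hg
  rw [robinForm_comm, e2, real_inner_comm] at e1
  have : (ν₂ - ν₁) * inner ℝ u v = 0 := by linarith
  exact (mul_eq_zero.1 this).resolve_left (sub_ne_zero.2 hne.symm)

end

section

variable {n : ℕ} {a b : Fin n → ℝ}

/-! ### The first two eigenvalues of the box -/

section Levels

variable (S : ∀ i, IntervalSpectrum (a i) (b i)) (α : ℝ)

/-- The product of the ground states of the edges. -/
def groundState : L2 a b :=
  toBox a b (contDiff_tensor fun i => ((S i).mode_φ α).smooth).continuous

theorem isRobinEigenfunction_groundState (hab : ∀ i, a i < b i) :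
    IsRobinEigenfunction a b α (∑ i, (S i).μ α) (groundState S α) :=
  isRobinEigenfunction_tensor hab (fun i => (S i).mode_φ α) fun i => by
    rw [(S i).φ_norm]; exact one_pos

theorem inner_groundState (hab : ∀ i, a i < b i) :
    inner ℝ (groundState S α) (groundState S α) = 1 := by
  rw [groundState, toBox, inner_toLp]
  simp only [← sq]
  rw [integral_tensor_sq hab, Finset.prod_eq_one fun i _ => (S i).φ_norm α]

/-- Excite edge `j` alone: use `ψ` there and the ground states on the other edges. -/
theorem exists_excitedState (hab : ∀ i, a i < b i) (j : Fin n) :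
    ∃ u : L2 a b, IsRobinEigenfunction a b α
      (∑ i, (S i).μ α + ((S j).ν α - (S j).μ α)) u := by
  have hy : ∀ i, RobinMode (a i) (b i) α
      ((S i).μ α + if i = j then (S j).ν α - (S j).μ α else 0)
      (if i = j then (S i).ψ α else (S i).φ α) := by
    intro i
    split_ifs with h
    · subst h; rw [add_sub_cancel]; exact (S i).mode_ψ α
    · rw [add_zero]; exact (S i).mode_φ α
  have h := isRobinEigenfunction_tensor hab hy fun i => by
    split_ifs with h
    · exact (S i).ψ_norm α
    · rw [(S i).φ_norm]; exact one_pos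
  rw [Finset.sum_add_distrib, Finset.sum_ite_eq' Finset.univ j] at h
  simp only [Finset.mem_univ, if_true] at h
  exact ⟨_, h⟩

variable {S α}

/-- An eigenvalue is either the ground state energy, with eigenfunction a multiple of the
ground state, or above the gap. -/
theorem IsRobinEigenfunction.dichotomy (hab : ∀ i, a i < b i) {γ ν : ℝ} (hγ : 0 < γ)
    (hγS : ∀ i, γ ≤ (S i).ν α - (S i).μ α) {u : L2 a b} (hu : IsRobinEigenfunction a b α ν u) :
    (ν = ∑ i, (S i).μ α ∧ ∃ c : ℝ, u = c • groundState S α) ∨ ∑ i, (S i).μ α + γ ≤ ν := by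
  have horth := hu.inner_eq_zero (isRobinEigenfunction_groundState S α hab)
  obtain ⟨hu0, G, g, hG, hg, hw⟩ := isRobinEigenfunction_iff.1 hu
  have hgap := gap_form S α hab hγ.le hγS hg
  -- Testing with `u` itself turns the form into `ν ‖u‖²`. At the ground energy the gap inequality
  -- becomes equality in Cauchy–Schwarz, forcing `u` to be a multiple of the ground state; otherwise
  -- orthogonality leaves `γ ‖u‖² ≤ (ν - ∑ μ) ‖u‖²`.
  rw [hw u G g hG hg] at hgap
  change γ * (_ - (inner ℝ u (groundState S α)) ^ 2) ≤ _ at hgap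
  have hpos : 0 < inner ℝ u u := real_inner_self_pos.2 hu0
  by_cases hν : ν = ∑ i, (S i).μ α
  · refine Or.inl ⟨hν, inner ℝ u (groundState S α), ?_⟩
    rw [hν, sub_self] at hgap
    have h1 := nonpos_of_mul_nonpos_right hgap hγ
    rw [← sub_eq_zero, ← real_inner_self_nonpos]
    have h2 := inner_groundState S α hab
    simp only [inner_sub_left, inner_sub_right, real_inner_smul_left, real_inner_smul_right, h2,
      real_inner_comm u (groundState S α)]
    rw [real_inner_comm]
    nlinarith
  · right
    rw [horth hν] at hgap
    by_contra h
    nlinarith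

theorem isLeast_robinLevels_one (hab : ∀ i, a i < b i) {γ : ℝ} (hγ : 0 < γ)
    (hγS : ∀ i, γ ≤ (S i).ν α - (S i).μ α) :
    IsLeast (robinLevels a b α 1) (∑ i, (S i).μ α) := by
  have hE := isRobinEigenfunction_groundState S α hab
  refine ⟨⟨fun _ => groundState S α, linearIndependent_unique_iff.2 hE.1,
    fun _ => ⟨_, le_rfl, hE⟩⟩, ?_⟩
  rintro μ ⟨u, -, hu⟩
  obtain ⟨ν, hν, h⟩ := hu 0
  rcases h.dichotomy hab hγ hγS with ⟨h1, -⟩ | h1 <;> linarith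

theorem isLeast_robinLevels_two (hab : ∀ i, a i < b i) {j : Fin n}
    (hj : ∀ i, (S j).ν α - (S j).μ α ≤ (S i).ν α - (S i).μ α) :
    IsLeast (robinLevels a b α 2) (∑ i, (S i).μ α + ((S j).ν α - (S j).μ α)) := by
  have hγ : 0 < (S j).ν α - (S j).μ α := sub_pos.2 ((S j).lt α)
  have hE := isRobinEigenfunction_groundState S α hab
  obtain ⟨w, hw⟩ := exists_excitedState S α hab j
  refine ⟨⟨![groundState S α, w], ?_, fun k => ?_⟩, ?_⟩
  · refine linearIndependent_of_ne_zero_of_inner_eq_zero (𝕜 := ℝ) ?_ ?_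
    · intro k; fin_cases k
      · exact hE.1
      · exact hw.1
    · have h0 := hE.inner_eq_zero hw (by linarith)
      intro k l hkl
      fin_cases k <;> fin_cases l
      · exact absurd rfl hkl
      · exact h0
      · exact (real_inner_comm _ _).trans h0
      · exact absurd rfl hkl
  · fin_cases k
    · exact ⟨_, by linarith, hE⟩
    · exact ⟨_, le_rfl, hw⟩
  · rintro μ ⟨u, hli, hu⟩
    -- Below the claimed level every eigenfunction is a multiple of the ground state, so two of them
    -- cannot be independent.
    by_contra hlt
    have hc : ∀ k, ∃ c : ℝ, u k = c • groundState S α := fun k => by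
      obtain ⟨ν, hν, h⟩ := hu k
      rcases h.dichotomy hab hγ hj with ⟨-, h1⟩ | h1
      · exact h1
      · exact absurd (h1.trans hν) hlt
    obtain ⟨c, hc0⟩ := hc 0
    obtain ⟨d, hd0⟩ := hc 1
    have := LinearIndependent.pair_iff.1 (by
      have e : ![u 0, u 1] = u := by ext k : 1; fin_cases k <;> rfl
      rw [e]; exact hli) d (-c) (by
      rw [hc0, hd0, smul_smul, smul_smul, ← add_smul]
      simp [mul_comm])
    have hcz : c = 0 := by simpa using this.2
    exact hli.ne_zero 0 (by rw [hc0, hcz, zero_smul])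

end Levels

end

end RobinBox

end

/-! ### Strict concavity for the box -/

theorem mainTheorem7 (n : ℕ) (hn : 1 ≤ n) (a b : Fin n → ℝ) (hab : ∀ i, a i < b i) :
    (∀ α : ℝ, IsLeast (RobinBox.robinLevels a b α 1) (RobinBox.robinEigenvalue a b 1 α)) ∧
    (∀ α : ℝ, IsLeast (RobinBox.robinLevels a b α 2) (RobinBox.robinEigenvalue a b 2 α)) ∧
    StrictConcaveOn ℝ Set.univ (fun α : ℝ => RobinBox.robinEigenvalue a b 1 α) ∧
    StrictConcaveOn ℝ Set.univ (fun α : ℝ => RobinBox.robinEigenvalue a b 2 α) := by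
  have S : ∀ i, RobinBox.IntervalSpectrum (a i) (b i) := fun i =>
    (RobinBox.nonempty_intervalSpectrum (hab i)).some
  have : Nonempty (Fin n) := ⟨⟨0, hn⟩⟩
  have hmin : ∀ α : ℝ, ∃ j, ∀ i, (S j).ν α - (S j).μ α ≤ (S i).ν α - (S i).μ α := fun α => by
    obtain ⟨j, -, hj⟩ := Finset.exists_min_image Finset.univ
      (fun i => (S i).ν α - (S i).μ α) Finset.univ_nonempty
    exact ⟨j, fun i => hj i (Finset.mem_univ i)⟩
  choose j hj using hmin
  have h1 : ∀ α, IsLeast (RobinBox.robinLevels a b α 1) (∑ i, (S i).μ α) := fun α =>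
    RobinBox.isLeast_robinLevels_one hab (sub_pos.2 ((S (j α)).lt α)) (hj α)
  have h2 : ∀ α, IsLeast (RobinBox.robinLevels a b α 2)
      (∑ i, (S i).μ α + ((S (j α)).ν α - (S (j α)).μ α)) := fun α =>
    RobinBox.isLeast_robinLevels_two hab (hj α)
  have e1 : ∀ α, RobinBox.robinEigenvalue a b 1 α = ∑ i, (S i).μ α := fun α => (h1 α).csInf_eq
  have e2 : ∀ α, RobinBox.robinEigenvalue a b 2 α
      = ∑ i, (S i).μ α + ((S (j α)).ν α - (S (j α)).μ α) := fun α => (h2 α).csInf_eq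
  refine ⟨fun α => by rw [e1]; exact h1 α, fun α => by rw [e2]; exact h2 α,
    RobinBox.strictConcaveOn_of_support fun α => ?_,
    RobinBox.strictConcaveOn_of_support fun α => ?_⟩
  · choose s hs using fun i => (S i).μ_support α
    refine ⟨∑ i, s i, fun β hβ => ?_⟩
    rw [e1, e1, Finset.sum_mul, ← Finset.sum_add_distrib]
    exact Finset.sum_lt_sum_of_nonempty Finset.univ_nonempty fun i _ => hs i β hβ
  · choose s hs using fun i => (S i).μ_support α
    obtain ⟨t, ht⟩ := (S (j α)).ν_support α
    have hsplit : ∀ β, ∑ i, (S i).μ β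
        = (S (j α)).μ β + ∑ i ∈ Finset.univ.erase (j α), (S i).μ β := fun β =>
      (Finset.add_sum_erase Finset.univ (fun i => (S i).μ β) (Finset.mem_univ _)).symm
    -- The line supports the branch with edge `j α` excited. At `β` the second eigenvalue is at most
    -- that branch, by minimality of `j β`, with equality at `α`. Strictness comes from the `ν` term
    -- alone, since the remaining sum is empty when `n = 1`.
    refine ⟨t + ∑ i ∈ Finset.univ.erase (j α), s i, fun β hβ => ?_⟩
    have h3 := hj β (j α)
    have h4 : ∑ i ∈ Finset.univ.erase (j α), (S i).μ β
        ≤ ∑ i ∈ Finset.univ.erase (j α), ((S i).μ α + s i * (β - α)) :=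
      Finset.sum_le_sum fun i _ => (hs i β hβ).le
    rw [Finset.sum_add_distrib, ← Finset.sum_mul] at h4
    have h5 := ht β hβ
    rw [e2, e2, hsplit α]
    have h6 := hsplit β
    linarith
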